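/- For $k\ge 1$ write $\mathbf x_k=(x_1,\dots,x_k)$, $\mathbf x_k'=(x_1',\dots,x_k')\in\mathbb R^{3k}$, $R_j=(-\Delta_{x_j})^{1/2}$, $R_j'=(-\Delta_{x_j'})^{1/2}$ and $R^{(k)}=\prod_{j=1}^k R_j\prod_{j=1}^k R_j'$. For $1\le j\le k$ let $B_{j,k+1}=B^1_{j,k+1}-B^2_{j,k+1}$, where $$B^1_{j,k+1}(\gamma)(t,\mathbf x_k,\mathbf x_k')=\iint \delta(x_j-x_{k+1})\,\delta(x_j-x_{k+1}')\,\gamma(t,\mathbf x_{k+1},\mathbf x_{k+1}')\,dx_{k+1}\,dx_{k+1}',$$ $$B^2_{j,k+1}(\gamma)(t,\mathbf x_k,\mathbf x_k')=\iint \delta(x_j'-x_{k+1})\,\delta(x_j'-x_{k+1}')\,\gamma(t,\mathbf x_{k+1},\mathbf x_{k+1}')\,dx_{k+1}\,dx_{k+1}'.$$ These integrals are understood as limits, in the sense of tempered distributions on $\mathbb R\times\mathbb R^{3k}\times\mathbb R^{3k}$ as $\varepsilon\to0^+$, of the same expressions with $\delta$ replaced by $\delta_\varepsilon(y)=\varepsilon^{-3}\chi(y/\varepsilon)$,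 for every Schwartz function $\chi$ on $\mathbb R^3$ with $\int\chi=1$. The statement $R^{(k)}T\in L^2$, for a tempered distribution $T$, means that the Fourier transform of $T$ is a function, whose product with the Fourier symbol of $R^{(k)}$ (that is, $\prod_j|\xi_j||\xi_j'|$ up to the normalization of the Fourier transform) is in $L^2$; on space-time, $R^{(k)}$ acts in the space variables only. **Theorem.** There is a constant $C$ such that the following holds for all integers $1\le j\le k$. Let $\gamma^{(k+1)}(t,\mathbf x_{k+1},\mathbf x'_{k+1})$ be a function on $\mathbb R\times\mathbb R^{3(k+1)}\times\mathbb R^{3(k+1)}$ such that, for each $t$, $(1+|\cdot|)^{-N}\gamma^{(k+1)}(t,\cdot)$ is integrable for some $N=N(t)$. Suppose that it solves $$\bigl(i\partial_t+\Delta_{\mathbf x_{k+1}}-\Delta_{\mathbf x'_{k+1}}\bigr)\gamma^{(k+1)}=0,\qquad \gamma^{(k+1)}(0,\cdot)=\gamma_0^{(k+1)},$$ in the sense that, for every Schwartz function $\varphi$, $t\mapsto\langle\gamma^{(k+1)}(t),\varphi\rangle=\int\gamma^{(k+1)}(t,\cdot)\,\varphi$ is differentiable on $\mathbb R$ with derivative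 $i\,\langle\gamma^{(k+1)}(t),(\Delta_{\mathbf x_{k+1}}-\Delta_{\mathbf x'_{k+1}})\varphi\rangle$. If $R^{(k+1)}\gamma_0^{(k+1)}\in L^2(\mathbb R^{3(k+1)}\times\mathbb R^{3(k+1)})$, then $B^1_{j,k+1}(\gamma^{(k+1)})$ and $B^2_{j,k+1}(\gamma^{(k+1)})$ exist as tempered distributions, $R^{(k)}B_{j,k+1}(\gamma^{(k+1)})\in L^2(\mathbb R\times\mathbb R^{3k}\times\mathbb R^{3k})$, and $$\bigl\|R^{(k)}B_{j,k+1}(\gamma^{(k+1)})\bigr\|_{L^2(\mathbb R\times\mathbb R^{3k}\times\mathbb R^{3k})}\le C\,\bigl\|R^{(k+1)}\gamma_0^{(k+1)}\bigr\|_{L^2(\mathbb R^{3(k+1)}\times\mathbb R^{3(k+1)})}.$$ In particular $C$ does not depend on $j$, $k$ or $\gamma^{(k+1)}$. -/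

import Mathlib

open MeasureTheory Filter Topology SchwartzMap LineDeriv FourierTransform

noncomputable section

/-- Physical space `ℝ³` with the Euclidean norm. -/
abbrev R3 : Type := EuclideanSpace ℝ (Fin 3)

/-- `ℝ^{3k} × ℝ^{3k}` as a Euclidean space: a point `z` is the pair `(𝐱_k, 𝐱'_k)` with
`x_i = z (Sum.inl i) ∈ ℝ³` and `x'_i = z (Sum.inr i) ∈ ℝ³`. Its volume is Lebesgue measure. -/
abbrev Conf (k : ℕ) : Type := PiLp 2 (fun _ : Fin k ⊕ Fin k => R3)

/-- Space-time `ℝ × ℝ^{3k} × ℝ^{3k}` as a Euclidean space (Lebesgue measure). -/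
abbrev STConf (k : ℕ) : Type := WithLp 2 (ℝ × Conf k)

/-- A function on a Euclidean space that is integrable against some power weight
`(1 + ‖x‖)^(-N)`, hence integrates against every Schwartz function. -/
def TemperedFun {V : Type*} [NormedAddCommGroup V] [MeasureSpace V] (g : V → ℂ) : Prop :=
  ∃ N : ℕ, Integrable (fun x => (((1 + ‖x‖) ^ N)⁻¹ : ℝ) • g x)

/-- The tempered distribution `T` is (integration against) the function `g`. -/
def Represents {V : Type*} [NormedAddCommGroup V] [NormedSpace ℝ V] [MeasureSpace V]
    (T : 𝓢'(V, ℂ)) (g : V → ℂ) : Prop :=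
  TemperedFun g ∧ ∀ φ : 𝓢(V, ℂ), T φ = ∫ x, g x * φ x

/-- The unit vector of `Conf k` in the direction of the `a`-th coordinate of the particle variable
with label `s` (`s = inl i` for `x_i`, `s = inr i` for `x'_i`). -/
def Conf.unit {k : ℕ} (s : Fin k ⊕ Fin k) (a : Fin 3) : Conf k :=
  PiLp.single 2 s (EuclideanSpace.single a (1 : ℝ))

/-- The operator `Δ_{𝐱_k} - Δ_{𝐱'_k}` on Schwartz functions. -/
def deltaPM {k : ℕ} (φ : 𝓢(Conf k, ℂ)) : 𝓢(Conf k, ℂ) :=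
  (∑ i : Fin k, ∑ a : Fin 3,
      ∂_{Conf.unit (Sum.inl i) a} (∂_{Conf.unit (Sum.inl i) a} φ)) -
    ∑ i : Fin k, ∑ a : Fin 3,
      ∂_{Conf.unit (Sum.inr i) a} (∂_{Conf.unit (Sum.inr i) a} φ)

/-- `γ` solves `(i ∂_t + Δ_{𝐱_k} - Δ_{𝐱'_k}) γ = 0` on `ℝ × ℝ^{3k} × ℝ^{3k}` in the sense of
tempered distributions in the space variables: for every Schwartz function `φ`, the function
`t ↦ ⟨γ(t), φ⟩` is differentiable with derivative `i ⟨γ(t), (Δ_{𝐱_k} - Δ_{𝐱'_k}) φ⟩`. -/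
structure IsFreeSolution {k : ℕ} (γ : ℝ → Conf k → ℂ) : Prop where
  tempered : ∀ t, TemperedFun (γ t)
  equation : ∀ (φ : 𝓢(Conf k, ℂ)) (t : ℝ),
    HasDerivAt (fun s => ∫ x, γ s x * φ x) (Complex.I * ∫ x, γ t x * deltaPM φ x) t

/-- The rescaled bump `δ_ε(y) = ε⁻³ χ(y / ε)` on `ℝ³`. -/
def approxDelta (χ : 𝓢(R3, ℂ)) (ε : ℝ) (y : R3) : ℂ :=
  ((ε ^ 3)⁻¹ : ℝ) • χ (ε⁻¹ • y)

/-- The point `(𝐱_k, 𝐱'_k)` obtained from `(𝐱_{k+1}, 𝐱'_{k+1})` by forgetting `x_{k+1}` and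
`x'_{k+1}`. -/
def Conf.forget {k : ℕ} (z : Conf (k + 1)) : Conf k :=
  WithLp.toLp 2 (fun s => z (Sum.map Fin.castSucc Fin.castSucc s))

/-- With `y` the variable labelled by `s` among `x_1, …, x_k, x'_1, …, x'_k`, this is
`∫ (∫∫ δ_ε(y - x_{k+1}) δ_ε(y - x'_{k+1}) γ(t, 𝐱_{k+1}, 𝐱'_{k+1}) dx_{k+1} dx'_{k+1})
  Φ(t, 𝐱_k, 𝐱'_k) d𝐱_k d𝐱'_k`. -/
def mollifiedPairing {k : ℕ} (s : Fin k ⊕ Fin k) (γ : ℝ → Conf (k + 1) → ℂ)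
    (χ : 𝓢(R3, ℂ)) (Φ : 𝓢(STConf k, ℂ)) (ε t : ℝ) : ℂ :=
  ∫ z : Conf (k + 1),
    approxDelta χ ε (z.forget s - z (Sum.inl (Fin.last k))) *
      approxDelta χ ε (z.forget s - z (Sum.inr (Fin.last k))) *
      γ t z * Φ (WithLp.toLp 2 (t, z.forget))

/-- `T = ∫∫ δ(y - x_{k+1}) δ(y - x'_{k+1}) γ(t, 𝐱_{k+1}, 𝐱'_{k+1}) dx_{k+1} dx'_{k+1}` as a tempered
distribution on space-time, `y` being the variable labelled by `s`: the limit, in the sense of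
tempered distributions, of the same expression with the delta function replaced by `δ_ε`,
for every approximation of the identity `δ_ε = ε⁻³ χ(· / ε)` with `χ` Schwartz and `∫ χ = 1`. -/
def IsCollapse {k : ℕ} (s : Fin k ⊕ Fin k) (γ : ℝ → Conf (k + 1) → ℂ)
    (T : 𝓢'(STConf k, ℂ)) : Prop :=
  ∀ χ : 𝓢(R3, ℂ), ∫ y, χ y = 1 → ∀ Φ : 𝓢(STConf k, ℂ),
    (∀ ε : ℝ, 0 < ε → Integrable (mollifiedPairing s γ χ Φ ε)) ∧
    Tendsto (fun ε : ℝ => ∫ t, mollifiedPairing s γ χ Φ ε t) (𝓝[>] 0) (𝓝 (T Φ))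

/-- `T = B_{j,k+1} γ = B¹_{j,k+1} γ - B²_{j,k+1} γ`, where `B¹` sets `x_{k+1} = x'_{k+1} = x_j` and
`B²` sets `x_{k+1} = x'_{k+1} = x'_j`. -/
def IsB {k : ℕ} (j : Fin k) (γ : ℝ → Conf (k + 1) → ℂ) (T : 𝓢'(STConf k, ℂ)) : Prop :=
  ∃ T₁ T₂ : 𝓢'(STConf k, ℂ),
    IsCollapse (Sum.inl j) γ T₁ ∧ IsCollapse (Sum.inr j) γ T₂ ∧ T = T₁ - T₂

/-- The Fourier symbol of `R^{(k)} = ∏_j (-Δ_{x_j})^{1/2} ∏_j (-Δ_{x'_j})^{1/2}`. With the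
normalization `∫ e^{-2πi x·ξ} f(x) dx` of the Fourier transform, `(-Δ_{x_j})^{1/2}` has symbol
`2π |ξ_j|`. -/
def rieszSymbol {k : ℕ} (ξ : Conf k) : ℝ :=
  ∏ s : Fin k ⊕ Fin k, (2 * Real.pi * ‖ξ s‖)

/-- `F ∈ L²(V)` is the image of the tempered distribution `T` under the Fourier multiplier with
symbol `m`: the Fourier transform of `T` is a function `h`, and `F̂ = m h`. -/
def IsMultiplierImage {V : Type*} [NormedAddCommGroup V] [InnerProductSpace ℝ V]
    [FiniteDimensional ℝ V] [MeasurableSpace V] [BorelSpace V]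
    (m : V → ℝ) (T : 𝓢'(V, ℂ)) (F : Lp ℂ 2 (volume : Measure V)) : Prop :=
  ∃ h : V → ℂ, Represents (𝓕 T) h ∧
    ((𝓕 F : Lp ℂ 2 (volume : Measure V)) : V → ℂ) =ᵐ[volume] fun ξ => (m ξ : ℂ) * h ξ

/-- `F = R^{(k)} T ∈ L²(ℝ^{3k} × ℝ^{3k})`. -/
def IsR {k : ℕ} (T : 𝓢'(Conf k, ℂ)) (F : Lp ℂ 2 (volume : Measure (Conf k))) : Prop :=
  IsMultiplierImage rieszSymbol T F

/-- `F = R^{(k)} T ∈ L²(ℝ × ℝ^{3k} × ℝ^{3k})`, where `R^{(k)}` acts in the space variables only. -/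
def IsSTR {k : ℕ} (T : 𝓢'(STConf k, ℂ)) (F : Lp ℂ 2 (volume : Measure (STConf k))) : Prop :=
  IsMultiplierImage (fun ζ : STConf k => rieszSymbol ζ.snd) T F

end

/-!
On the Fourier side a free solution is determined by its initial value. Let `h` be the Fourier
transform of `γ₀`, let `θ(ζ) = -(2π)² (∑ |ζᵢ|² - ∑ |ζ'ᵢ|²)` be the symbol of `Δ - Δ'`, and write `η`,
`η'` for the last two momenta in `ζ`. Setting `x_{k+1} = x'_{k+1} = x_s` adds `η + η'` to the momentum
labelled by `s` (`Conf.collapse`), so the collapsed solution, tested against `Φ` in space-time, is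
`∫ h(ζ) (𝓕⁻ Φ)(π ζ) dζ` with `π ζ = (θ(ζ) / 2π, collapse ζ)` (`collapseLift`). With `δ_ε` in place of
`δ` the integrand is multiplied by `χ̂(εη) χ̂(εη')`
(`integral_mollifiedPairing`), which tends to `1` and is bounded.

Everything therefore rests on the `L²` boundedness of `g ↦ W · (g ∘ π)`, where `W` is the quotient of
the symbol of `R^{(k)}` at `collapse ζ` by that of `R^{(k+1)}` at `ζ`. This follows from
`∫ W² (Θ ∘ π) ≤ C ∫ Θ` for `Θ ≥ 0` (`lintegral_weight_mul_collapseLift_le`). After the change of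
variables that makes the collapsed momentum `p = ξ_s` a coordinate, the claim is that, uniformly in
`p ∈ ℝ³`, the measure `|p|² / (|x|² |y|² |z|²)` on `{x + y + z = p}` is pushed forward by
`± |x|² ± |y|² ± |z|²` to a measure on `ℝ` with bounded density (`lintegral_collapseIntegrand_le`).
To see this, order `|x| ≤ |y| ≤ |z|`. For fixed `x`, bipolar coordinates turn `dy` into
`π / (2|p - x|) d|y|² d|z|²`, so the variable `|z|²` absorbs `Θ`; as
`|p|^{3/2} |y|^{1/2} ≤ 9 |z|²`, the remaining integral in `|y|² ≥ |x|²` converges and leaves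
`|p|^{1/2} |x|^{-5/2} |p - x|^{-1}`, whose integral over `x ∈ ℝ³` is bounded, again in bipolar
coordinates.

Given the bound, the transpose of `g ↦ W · (g ∘ π)` sends `R^{(k+1)} h` to some `K ∈ L²` on
space-time, and the Fourier transform of the collapse is `K` divided by the symbol of `R^{(k)}`
(`exists_collapse_representative`).

That a weak solution is the one given by the phase `exp(i t θ)` (`integral_mul_eq_integral_phase`) is
proved by showing that `⟨γ(s), 𝓕 (e^{iτθ} g)⟩` depends only on `s + τ`. Since `γ` is only weakly
differentiable in time, this needs bounds that are uniform over bounded families of Schwartz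
functions; they come from the Banach–Steinhaus theorem (`SchwartzBounded.uniform_bound`).
-/

noncomputable section

/-! ### Bipolar coordinates and power integrals -/

/-- Polar coordinates in the plane for radial functions, with `σ = r²` as variable. -/
theorem lintegral_sq_add_sq (g : ℝ → ENNReal) (hg : Measurable g) :
    ∫⁻ q : ℝ × ℝ, g (q.1 ^ 2 + q.2 ^ 2) = ENNReal.ofReal Real.pi * ∫⁻ σ in Set.Ioi 0, g σ := by
  have himg : (fun r : ℝ => r ^ 2) '' Set.Ioi 0 = Set.Ioi 0 := by
    ext s
    constructor
    · rintro ⟨r, hr, rfl⟩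
      exact pow_pos (show (0 : ℝ) < r from hr) 2
    · intro hs
      exact ⟨√s, Real.sqrt_pos.2 hs, Real.sq_sqrt (le_of_lt hs)⟩
  have hsub : ∫⁻ σ in Set.Ioi 0, g σ = ∫⁻ r in Set.Ioi (0 : ℝ), ENNReal.ofReal |2 * r| * g (r ^ 2) := by
    conv_lhs => rw [← himg]
    refine lintegral_image_eq_lintegral_abs_deriv_mul measurableSet_Ioi
      (fun x _ => ?_) (fun x hx y hy h => ?_) g
    · simpa using (hasDerivAt_pow 2 x).hasDerivWithinAt
    · exact (pow_left_inj₀ (le_of_lt hx) (le_of_lt hy) two_ne_zero).1 h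
  rw [hsub, ← lintegral_comp_polarCoord_symm]
  have h1 : ∀ p : ℝ × ℝ, ENNReal.ofReal p.1 • g ((polarCoord.symm p).1 ^ 2 + (polarCoord.symm p).2 ^ 2)
      = ENNReal.ofReal p.1 * g (p.1 ^ 2) := by
    intro p
    simp only [polarCoord_symm_apply, smul_eq_mul]
    congr 2
    rw [mul_pow, mul_pow, ← mul_add, Real.cos_sq_add_sin_sq, mul_one]
  simp_rw [h1]
  rw [show polarCoord.target = Set.Ioi (0 : ℝ) ×ˢ Set.Ioo (-Real.pi) Real.pi from rfl,
    Measure.volume_eq_prod, ← Measure.prod_restrict, lintegral_prod _ (by fun_prop),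
    ← lintegral_const_mul _ (by fun_prop)]
  refine setLIntegral_congr_fun measurableSet_Ioi fun r hr => ?_
  simp only [lintegral_const, Measure.restrict_apply MeasurableSet.univ, Set.univ_inter,
    Real.volume_Ioo]
  rw [abs_of_pos (by have : (0 : ℝ) < r := hr; positivity), ENNReal.ofReal_mul zero_le_two,
    show Real.pi - -Real.pi = 2 * Real.pi by ring, ENNReal.ofReal_mul zero_le_two]
  ring

/-- Integration over `ℝ³` in cylindrical coordinates about the first axis. -/
theorem lintegral_R3_cylindrical (f : ℝ → ℝ → ENNReal) (hf : Measurable (Function.uncurry f)) :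
    ∫⁻ y : R3, f (y 0) (‖y‖ ^ 2) =
      ENNReal.ofReal Real.pi * ∫⁻ u : ℝ, ∫⁻ R in Set.Ioi (u ^ 2), f u R := by
  have e : MeasurePreserving (fun y : R3 => (y 0, (y 1, y 2))) volume volume :=
    ((MeasurePreserving.id (volume : Measure ℝ)).prod (volume_preserving_finTwoArrow ℝ)).comp
      ((volume_preserving_piFinSuccAbove (fun _ : Fin 3 => ℝ) 0).comp
        (EuclideanSpace.volume_preserving_symm_measurableEquiv_toLp (Fin 3)))
  have hn : ∀ y : R3, ‖y‖ ^ 2 = y 0 ^ 2 + (y 1 ^ 2 + y 2 ^ 2) := by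
    intro y
    rw [EuclideanSpace.norm_sq_eq, Fin.sum_univ_three]
    simp [add_assoc]
  have hg : Measurable fun p : ℝ × ℝ × ℝ => f p.1 (p.1 ^ 2 + (p.2.1 ^ 2 + p.2.2 ^ 2)) :=
    hf.comp (Measurable.prodMk (by fun_prop) (by fun_prop))
  simp only [hn]
  rw [e.lintegral_comp hg, Measure.volume_eq_prod, lintegral_prod _ hg.aemeasurable]
  rw [← lintegral_const_mul _ (by
    have h : ∀ u : ℝ, ∫⁻ R in Set.Ioi (u ^ 2), f u R
        = ∫⁻ R, Set.indicator {p : ℝ × ℝ | p.1 ^ 2 < p.2} (Function.uncurry f) (u, R) := by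
      intro u
      rw [← lintegral_indicator measurableSet_Ioi]
      refine lintegral_congr fun R => ?_
      simp [Set.indicator_apply]
    simp_rw [h]
    exact (hf.indicator (measurableSet_lt (by fun_prop) (by fun_prop))).lintegral_prod_right')]
  refine lintegral_congr fun u => ?_
  have hfu : Measurable fun σ => f u (u ^ 2 + σ) :=
    hf.comp (Measurable.prodMk measurable_const (by fun_prop))
  have := lintegral_sq_add_sq (fun σ => f u (u ^ 2 + σ)) hfu
  refine this.trans ?_
  congr 1
  rw [← lintegral_indicator measurableSet_Ioi, ← lintegral_indicator measurableSet_Ioi,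
    ← lintegral_add_left_eq_self ((Set.Ioi (u ^ 2)).indicator (f u)) (u ^ 2)]
  refine lintegral_congr fun R => ?_
  simp [Set.indicator_apply]

/-- Bipolar coordinates in `ℝ³`: the law of `(‖y‖², ‖A - y‖²)` under Lebesgue measure has constant
density `π / (2 ‖A‖)` on the set of pairs satisfying the triangle inequality. -/
theorem lintegral_R3_bipolar (f : ℝ → ℝ → ENNReal) (hf : Measurable (Function.uncurry f)) (A : R3)
    (hA : A ≠ 0) :
    ENNReal.ofReal (2 * ‖A‖) * ∫⁻ y : R3, f (‖y‖ ^ 2) (‖A - y‖ ^ 2) =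
      ENNReal.ofReal Real.pi * ∫⁻ R : ℝ, ∫⁻ s : ℝ,
        Set.indicator {s | (R + ‖A‖ ^ 2 - s) ^ 2 < 4 * ‖A‖ ^ 2 * R} (f R) s := by
  set a := ‖A‖ with ha
  have ha0 : 0 < a := norm_pos_iff.2 hA
  -- Reflect `A` onto the first axis and use cylindrical coordinates about it.
  set B : R3 := EuclideanSpace.single 0 a with hB
  have hBA : ‖A‖ = ‖B‖ := by simp [hB, ha]
  set ρ := (Submodule.span ℝ {A - B})ᗮ.reflection with hρ
  have hρA : ρ A = B := Submodule.reflection_sub hBA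
  have h1 : ∫⁻ y : R3, f (‖y‖ ^ 2) (‖A - y‖ ^ 2) = ∫⁻ y : R3, f (‖y‖ ^ 2) (‖B - y‖ ^ 2) := by
    rw [← ρ.measurePreserving.lintegral_comp_emb ρ.toMeasurableEquiv.measurableEmbedding
      (fun y : R3 => f (‖y‖ ^ 2) (‖B - y‖ ^ 2))]
    refine lintegral_congr fun y => ?_
    rw [← hρA, ← map_sub, LinearIsometryEquiv.norm_map, LinearIsometryEquiv.norm_map]
  have h2 : ∀ y : R3, ‖B - y‖ ^ 2 = ‖y‖ ^ 2 + a ^ 2 - 2 * a * y 0 := by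
    intro y
    rw [norm_sub_sq_real, ← hBA, ← ha]
    simp [hB, EuclideanSpace.inner_single_left]
    ring
  have hF : Measurable (Function.uncurry fun u R => f R (R + a ^ 2 - 2 * a * u)) :=
    hf.comp (Measurable.prodMk (by fun_prop) (by fun_prop))
  rw [h1]
  simp_rw [h2]
  rw [lintegral_R3_cylindrical (fun u R => f R (R + a ^ 2 - 2 * a * u)) hF]
  have hset : MeasurableSet {p : ℝ × ℝ | p.1 ^ 2 < p.2} :=
    measurableSet_lt (by fun_prop) (by fun_prop)
  have h3 : ∀ u : ℝ, ∫⁻ R in Set.Ioi (u ^ 2), f R (R + a ^ 2 - 2 * a * u)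
      = ∫⁻ R, Set.indicator {p : ℝ × ℝ | p.1 ^ 2 < p.2}
        (Function.uncurry fun u R => f R (R + a ^ 2 - 2 * a * u)) (u, R) := by
    intro u
    rw [← lintegral_indicator measurableSet_Ioi]
    refine lintegral_congr fun R => ?_
    simp [Set.indicator_apply]
  simp_rw [h3]
  rw [lintegral_lintegral_swap (f := fun u R => Set.indicator {p : ℝ × ℝ | p.1 ^ 2 < p.2}
    (Function.uncurry fun u R => f R (R + a ^ 2 - 2 * a * u)) (u, R))
    (hF.indicator hset).aemeasurable, mul_left_comm,
    ← lintegral_const_mul _ (hF.indicator hset).lintegral_prod_left']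
  congr 1
  refine lintegral_congr fun R => ?_
  have himg : (fun u : ℝ => R + a ^ 2 - 2 * a * u) '' Set.univ = Set.univ := by
    rw [Set.image_univ]
    refine Set.range_eq_univ.2 fun s => ⟨(R + a ^ 2 - s) / (2 * a), ?_⟩
    field_simp
    ring
  have hsub := lintegral_image_eq_lintegral_abs_deriv_mul (s := Set.univ)
    (f := fun u : ℝ => R + a ^ 2 - 2 * a * u) (f' := fun _ => -(2 * a)) MeasurableSet.univ
    (fun x _ => by
      simpa using ((hasDerivAt_id x).const_mul (2 * a)).const_sub (R + a ^ 2))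
    (fun x _ y _ h => by
      have h' : 2 * a * x = 2 * a * y := by simpa using h
      exact mul_left_cancel₀ (by positivity) h')
    (Set.indicator {s | (R + a ^ 2 - s) ^ 2 < 4 * a ^ 2 * R} (f R))
  rw [himg, setLIntegral_univ, setLIntegral_univ] at hsub
  rw [hsub, abs_neg, abs_of_pos (by positivity),
    ← lintegral_const_mul' _ _ ENNReal.ofReal_ne_top]
  refine lintegral_congr fun u => ?_
  congr 1
  simp only [Set.indicator_apply, Set.mem_ofPred_eq, Function.uncurry]
  have : (R + a ^ 2 - (R + a ^ 2 - 2 * a * u)) ^ 2 < 4 * a ^ 2 * R ↔ u ^ 2 < R := by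
    rw [show (R + a ^ 2 - (R + a ^ 2 - 2 * a * u)) ^ 2 = 4 * a ^ 2 * u ^ 2 by ring]
    exact mul_lt_mul_iff_right₀ (by positivity)
  simp only [this]

theorem setLIntegral_Ioo_sq_rpow_neg_half {a b : ℝ} (ha : 0 ≤ a) (hab : a ≤ b) :
    ∫⁻ s in Set.Ioo (a ^ 2) (b ^ 2), ENNReal.ofReal (s ^ (-(1 / 2) : ℝ)) =
      ENNReal.ofReal (2 * (b - a)) := by
  have hab2 : a ^ 2 ≤ b ^ 2 := by gcongr
  have hint : IntervalIntegrable (fun s : ℝ => s ^ (-(1 / 2) : ℝ)) volume (a ^ 2) (b ^ 2) :=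
    intervalIntegral.intervalIntegrable_rpow' (by norm_num)
  rw [restrict_Ioo_eq_restrict_Ioc,
    ← ofReal_integral_eq_lintegral_ofReal ((intervalIntegrable_iff_integrableOn_Ioc_of_le hab2).1 hint)
      ((ae_restrict_iff' measurableSet_Ioc).2 (Eventually.of_forall fun s hs =>
        Real.rpow_nonneg ((sq_nonneg a).trans hs.1.le) _)),
    ← intervalIntegral.integral_of_le hab2, integral_rpow (Or.inl (by norm_num))]
  congr 1
  have h (c : ℝ) (hc : 0 ≤ c) : (c ^ 2) ^ (-(1 / 2) + 1 : ℝ) = c := by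
    rw [← Real.rpow_natCast, ← Real.rpow_mul hc]
    norm_num
  rw [h a ha, h b (ha.trans hab)]
  ring

theorem setLIntegral_Ioi_rpow {a c : ℝ} (ha : a < -1) (hc : 0 < c) :
    ∫⁻ t in Set.Ioi c, ENNReal.ofReal (t ^ a) = ENNReal.ofReal (-c ^ (a + 1) / (a + 1)) := by
  rw [← integral_Ioi_rpow_of_lt ha hc, ofReal_integral_eq_lintegral_ofReal
    (integrableOn_Ioi_rpow_of_lt ha hc)]
  exact (ae_restrict_iff' measurableSet_Ioi).2 (Eventually.of_forall fun s hs =>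
        Real.rpow_nonneg (hc.trans hs).le _)

theorem setLIntegral_Ioc_zero_rpow {a c : ℝ} (ha : -1 < a) (hc : 0 ≤ c) :
    ∫⁻ t in Set.Ioc 0 c, ENNReal.ofReal (t ^ a) = ENNReal.ofReal (c ^ (a + 1) / (a + 1)) := by
  have hint : IntervalIntegrable (fun s : ℝ => s ^ a) volume 0 c :=
    intervalIntegral.intervalIntegrable_rpow' ha
  rw [← ofReal_integral_eq_lintegral_ofReal ((intervalIntegrable_iff_integrableOn_Ioc_of_le hc).1 hint)
      ((ae_restrict_iff' measurableSet_Ioc).2 (Eventually.of_forall fun s hs =>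
        Real.rpow_nonneg hs.1.le _)),
    ← intervalIntegral.integral_of_le hc, integral_rpow (Or.inl ha),
    Real.zero_rpow (by linarith), sub_zero]

/-- The bound `∫ |x|^{-5/2} |p - x|^{-1} dx ≤ 16 π |p|^{-1/2}` on `ℝ³`, multiplied by `2 |p|`. -/
theorem lintegral_rpow_mul_inv_norm_sub_le (p : R3) (hp : p ≠ 0) :
    ENNReal.ofReal (2 * ‖p‖) * ∫⁻ x : R3, ENNReal.ofReal ((‖x‖ ^ 2) ^ (-(5 / 4) : ℝ) * ‖p - x‖⁻¹) ≤
      ENNReal.ofReal (32 * Real.pi * ‖p‖ ^ (1 / 2 : ℝ)) := by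
  have hP : 0 < ‖p‖ := norm_pos_iff.2 hp
  have key := lintegral_R3_bipolar
    (fun R s => ENNReal.ofReal (R ^ (-(5 / 4) : ℝ) * s ^ (-(1 / 2) : ℝ))) (by fun_prop) p hp
  have h1 : ∀ x : R3, (‖p - x‖ ^ 2) ^ (-(1 / 2) : ℝ) = ‖p - x‖⁻¹ := by
    intro x
    rw [← Real.rpow_natCast, ← Real.rpow_mul (norm_nonneg _), ← Real.rpow_neg_one]
    norm_num
  simp_rw [h1] at key
  rw [key]
  set P := ‖p‖
  have h2 : ∀ R : ℝ, ∫⁻ s : ℝ, Set.indicator {s | (R + P ^ 2 - s) ^ 2 < 4 * P ^ 2 * R}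
      (fun s => ENNReal.ofReal (R ^ (-(5 / 4) : ℝ) * s ^ (-(1 / 2) : ℝ))) s ≤
      (Set.Ioc 0 (P ^ 2)).indicator (fun R => ENNReal.ofReal 4 * ENNReal.ofReal (R ^ (-(3 / 4) : ℝ))) R +
      (Set.Ioi (P ^ 2)).indicator
        (fun R => ENNReal.ofReal (4 * P) * ENNReal.ofReal (R ^ (-(5 / 4) : ℝ))) R := by
    intro R
    rcases le_or_gt R 0 with hR | hR
    · have : {s | (R + P ^ 2 - s) ^ 2 < 4 * P ^ 2 * R} = ∅ := by
        ext s
        simp only [Set.mem_ofPred_eq, Set.mem_empty_iff_false, iff_false, not_lt]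
        exact (mul_nonpos_of_nonneg_of_nonpos (by positivity) hR).trans (sq_nonneg _)
      simp [this]
    · set r := √R with hr
      have hr0 : 0 < r := Real.sqrt_pos.2 hR
      have hRr : R = r ^ 2 := (Real.sq_sqrt hR.le).symm
      -- the triangle inequality `|P - r| < |p - x| < P + r` for the sides `P`, `r = ‖x‖`
      have hset : {s | (R + P ^ 2 - s) ^ 2 < 4 * P ^ 2 * R} = Set.Ioo (|P - r| ^ 2) ((P + r) ^ 2) := by
        ext s
        simp only [Set.mem_ofPred_eq, Set.mem_Ioo, sq_abs]
        rw [hRr, show 4 * P ^ 2 * r ^ 2 = (2 * P * r) ^ 2 by ring, sq_lt_sq,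
          abs_of_pos (show 0 < 2 * P * r by positivity), abs_lt]
        constructor <;> rintro ⟨h, h'⟩ <;> constructor <;> nlinarith
      have hle : |P - r| ≤ P + r := abs_le.2 ⟨by linarith, by linarith⟩
      rw [hset, lintegral_indicator measurableSet_Ioo]
      simp_rw [ENNReal.ofReal_mul (Real.rpow_nonneg hR.le _)]
      rw [lintegral_const_mul' _ _ ENNReal.ofReal_ne_top,
        setLIntegral_Ioo_sq_rpow_neg_half (abs_nonneg _) hle]
      rcases le_or_gt R (P ^ 2) with h | h
      · rw [Set.indicator_of_mem (Set.mem_Ioc.2 ⟨hR, h⟩)]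
        refine le_trans ?_ le_self_add
        rw [← ENNReal.ofReal_mul (Real.rpow_nonneg hR.le _), ← ENNReal.ofReal_mul (by norm_num)]
        refine ENNReal.ofReal_le_ofReal ?_
        have hrR : r = R ^ (1 / 2 : ℝ) := Real.sqrt_eq_rpow R
        have h34 : R ^ (-(3 / 4) : ℝ) = R ^ (-(5 / 4) : ℝ) * r := by
          rw [hrR, ← Real.rpow_add hR]
          norm_num
        rw [h34]
        have : P - r ≤ |P - r| := le_abs_self _
        have h0 := Real.rpow_nonneg hR.le (-(5 / 4) : ℝ)
        nlinarith
      · rw [Set.indicator_of_mem (Set.mem_Ioi.2 h)]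
        refine le_trans ?_ le_add_self
        rw [mul_comm (ENNReal.ofReal (4 * P))]
        refine mul_le_mul_right (ENNReal.ofReal_le_ofReal ?_) _
        linarith [neg_abs_le (P - r)]
  calc _ ≤ ENNReal.ofReal Real.pi * ∫⁻ R : ℝ, ((Set.Ioc 0 (P ^ 2)).indicator
          (fun R => ENNReal.ofReal 4 * ENNReal.ofReal (R ^ (-(3 / 4) : ℝ))) R +
        (Set.Ioi (P ^ 2)).indicator
          (fun R => ENNReal.ofReal (4 * P) * ENNReal.ofReal (R ^ (-(5 / 4) : ℝ))) R) := by
        gcongr with R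
        exact h2 R
    _ = _ := by
        rw [lintegral_add_left (Measurable.indicator (by fun_prop) measurableSet_Ioc),
          lintegral_indicator measurableSet_Ioc, lintegral_indicator measurableSet_Ioi,
          lintegral_const_mul' _ _ ENNReal.ofReal_ne_top,
          lintegral_const_mul' _ _ ENNReal.ofReal_ne_top,
          setLIntegral_Ioc_zero_rpow (by norm_num) (sq_nonneg P),
          setLIntegral_Ioi_rpow (by norm_num) (by positivity)]
        have e1 : (P ^ 2) ^ (-(3 / 4) + 1 : ℝ) = P ^ (1 / 2 : ℝ) := by
          rw [← Real.rpow_natCast, ← Real.rpow_mul hP.le]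
          norm_num
        have e2 : (P ^ 2) ^ (-(5 / 4) + 1 : ℝ) = P ^ (1 / 2 : ℝ) * P⁻¹ := by
          rw [← Real.rpow_natCast, ← Real.rpow_mul hP.le, ← Real.rpow_neg_one, ← Real.rpow_add hP]
          norm_num
        have h0 := Real.rpow_nonneg hP.le (1 / 2 : ℝ)
        rw [e1, e2, ← ENNReal.ofReal_mul (by norm_num), ← ENNReal.ofReal_mul (by positivity),
          ← ENNReal.ofReal_add (by positivity) (by
            rw [show 4 * P * (-(P ^ (1 / 2 : ℝ) * P⁻¹) / (-(5 / 4) + 1 : ℝ)) =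
              16 * P * (P ^ (1 / 2 : ℝ) * P⁻¹) by ring]
            positivity), ← ENNReal.ofReal_mul Real.pi_pos.le]
        congr 1
        field_simp
        norm_num

/-! ### The momentum space estimate for three momenta with fixed sum -/

theorem lintegral_comp_add_mul (g : ℝ → ENNReal) (c : ℝ) {e : ℝ} (he : e = 1 ∨ e = -1) :
    ∫⁻ s, g (c + e * s) = ∫⁻ s, g s := by
  rcases he with rfl | rfl
  · simpa using lintegral_add_left_eq_self g c
  · simpa [sub_eq_add_neg] using lintegral_sub_left_eq_self g c

/-- The weighted integrand of the collapsing estimate: `x`, `y`, `z` are the three momenta with sum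
`p`, and `e₁`, `e₂`, `e₃` the signs with which their squares enter the phase. -/
def collapseIntegrand (Ψ : ℝ → ENNReal) (P e₁ e₂ e₃ : ℝ) (x y z : R3) : ENNReal :=
  ENNReal.ofReal (P ^ 2 / (‖x‖ ^ 2 * ‖y‖ ^ 2 * ‖z‖ ^ 2)) *
    Ψ (e₁ * ‖x‖ ^ 2 + e₂ * ‖y‖ ^ 2 + e₃ * ‖z‖ ^ 2)

/-- `collapseIntegrand` restricted to `‖x‖ ≤ ‖y‖ ≤ ‖z‖`. -/
def orderedIntegrand (Ψ : ℝ → ENNReal) (P e₁ e₂ e₃ : ℝ) (x y z : R3) : ENNReal :=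
  if ‖x‖ ≤ ‖y‖ ∧ ‖y‖ ≤ ‖z‖ then collapseIntegrand Ψ P e₁ e₂ e₃ x y z else 0

theorem measurable_collapseIntegrand {Ψ : ℝ → ENNReal} (hΨ : Measurable Ψ) (P e₁ e₂ e₃ : ℝ) :
    Measurable fun q : R3 × R3 × R3 => collapseIntegrand Ψ P e₁ e₂ e₃ q.1 q.2.1 q.2.2 := by
  unfold collapseIntegrand
  refine Measurable.mul (by fun_prop) (hΨ.comp (by fun_prop))

theorem measurable_orderedIntegrand {Ψ : ℝ → ENNReal} (hΨ : Measurable Ψ) (P e₁ e₂ e₃ : ℝ) :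
    Measurable fun q : R3 × R3 × R3 => orderedIntegrand Ψ P e₁ e₂ e₃ q.1 q.2.1 q.2.2 := by
  unfold orderedIntegrand
  refine Measurable.ite ?_ (measurable_collapseIntegrand hΨ P e₁ e₂ e₃) measurable_const
  exact (measurableSet_le (f := fun q : R3 × R3 × R3 => ‖q.1‖) (g := fun q => ‖q.2.1‖)
    (by fun_prop) (by fun_prop)).inter
    (measurableSet_le (f := fun q : R3 × R3 × R3 => ‖q.2.1‖) (g := fun q => ‖q.2.2‖)
    (by fun_prop) (by fun_prop))

/-- The integral in the middle momentum `y`: bipolar coordinates make `‖z‖²` an integration variable,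
which removes `Ψ`, and the interpolated weight `‖p‖^{1/2} ‖x‖⁻² ‖y‖^{-5/2}` is integrable in
`‖y‖² ≥ ‖x‖²`. -/
theorem lintegral_orderedIntegrand_inner_le {Ψ : ℝ → ENNReal} (hΨ : Measurable Ψ) {e₁ e₂ e₃ : ℝ}
    (he : e₃ = 1 ∨ e₃ = -1) {p x : R3} (hp : p ≠ 0) (hx : x ≠ 0) (hxp : p - x ≠ 0) :
    ∫⁻ y : R3, orderedIntegrand Ψ ‖p‖ e₁ e₂ e₃ x y (p - x - y) ≤
      ENNReal.ofReal (18 * Real.pi * ‖p‖ ^ (1 / 2 : ℝ)) *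
        ENNReal.ofReal ((‖x‖ ^ 2) ^ (-(5 / 4) : ℝ) * ‖p - x‖⁻¹) * ∫⁻ s, Ψ s := by
  have hP : 0 < ‖p‖ := norm_pos_iff.2 hp
  have hX : 0 < ‖x‖ := norm_pos_iff.2 hx
  have hA : 0 < ‖p - x‖ := norm_pos_iff.2 hxp
  set P := ‖p‖ with hPdef
  set X := ‖x‖ ^ 2 with hXdef
  have hX2 : 0 < X := by positivity
  set K : ℝ := 9 * P ^ (1 / 2 : ℝ) * X⁻¹ with hK
  have hK0 : 0 ≤ K := by positivity
  set f : ℝ → ℝ → ENNReal := fun R s => (Set.Ici X).indicator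
    (fun R => ENNReal.ofReal (K * R ^ (-(5 / 4) : ℝ))) R * Ψ (e₁ * X + e₂ * R + e₃ * s) with hf
  have hfm : Measurable (Function.uncurry f) := by
    refine Measurable.mul ?_ (hΨ.comp (by fun_prop))
    exact (Measurable.indicator (by fun_prop) measurableSet_Ici).comp measurable_fst
  have h1 : ∀ y : R3, orderedIntegrand Ψ P e₁ e₂ e₃ x y (p - x - y) ≤
      f (‖y‖ ^ 2) (‖p - x - y‖ ^ 2) := by
    intro y
    unfold orderedIntegrand
    split_ifs with h
    swap
    · exact zero_le
    obtain ⟨hxy, hyz⟩ := h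
    set z := p - x - y with hz
    have hY : 0 < ‖y‖ := hX.trans_le hxy
    have hZ : 0 < ‖z‖ := hY.trans_le hyz
    have hPz : P ≤ 3 * ‖z‖ := by
      have : p = x + y + z := by rw [hz]; abel
      calc P = ‖x + y + z‖ := by rw [hPdef, ← this]
        _ ≤ ‖x‖ + ‖y‖ + ‖z‖ := norm_add₃_le
        _ ≤ 3 * ‖z‖ := by linarith
    rw [hf]
    simp only
    rw [Set.indicator_of_mem (show ‖y‖ ^ 2 ∈ Set.Ici X from Set.mem_Ici.2 (by rw [hXdef]; gcongr))]
    unfold collapseIntegrand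
    refine mul_le_mul_left (ENNReal.ofReal_le_ofReal ?_) _
    -- interpolate the two lower bounds `‖y‖² ≤ ‖z‖²` and `P² ≤ 9 ‖z‖²`
    set Y := ‖y‖ ^ 2 with hYdef
    set Z := ‖z‖ ^ 2 with hZdef
    have hY2 : 0 < Y := by positivity
    have hZ2 : 0 < Z := by positivity
    have hYZ : Y ≤ Z := by rw [hYdef, hZdef]; gcongr
    have hPZ : P ^ 2 ≤ 9 * Z := by
      calc P ^ 2 ≤ (3 * ‖z‖) ^ 2 := by gcongr
        _ = 9 * Z := by rw [hZdef]; ring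
    have h9 : P ^ (3 / 2 : ℝ) * Y ^ (1 / 4 : ℝ) ≤ 9 * Z := by
      have e1 : P ^ (3 / 2 : ℝ) = (P ^ 2) ^ (3 / 4 : ℝ) := by
        rw [← Real.rpow_natCast, ← Real.rpow_mul hP.le]
        norm_num
      calc P ^ (3 / 2 : ℝ) * Y ^ (1 / 4 : ℝ)
          ≤ (9 * Z) ^ (3 / 4 : ℝ) * (9 * Z) ^ (1 / 4 : ℝ) := by
            rw [e1]
            gcongr
            linarith
        _ = 9 * Z := by
            rw [← Real.rpow_add (by positivity)]
            norm_num
    have e2 : Y ^ (-(5 / 4) : ℝ) = Y⁻¹ * (Y ^ (1 / 4 : ℝ))⁻¹ := by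
      rw [← Real.rpow_neg hY2.le, ← Real.rpow_neg_one, ← Real.rpow_add hY2]
      norm_num
    have e3 : P ^ 2 = P ^ (3 / 2 : ℝ) * P ^ (1 / 2 : ℝ) := by
      rw [← Real.rpow_natCast, ← Real.rpow_add hP]
      norm_num
    have hy4 : 0 < Y ^ (1 / 4 : ℝ) := by positivity
    have hp2 : 0 < P ^ (1 / 2 : ℝ) := by positivity
    rw [hK, e2, e3, div_le_iff₀ (by positivity)]
    calc P ^ (3 / 2 : ℝ) * P ^ (1 / 2 : ℝ)
        = (P ^ (3 / 2 : ℝ) * Y ^ (1 / 4 : ℝ)) * P ^ (1 / 2 : ℝ) * (Y ^ (1 / 4 : ℝ))⁻¹ := by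
          field_simp
      _ ≤ (9 * Z) * P ^ (1 / 2 : ℝ) * (Y ^ (1 / 4 : ℝ))⁻¹ := by gcongr
      _ = _ := by
          rw [← hXdef]
          field_simp
  have h2 : ENNReal.ofReal (2 * ‖p - x‖) * ∫⁻ y : R3, orderedIntegrand Ψ P e₁ e₂ e₃ x y (p - x - y)
      ≤ ENNReal.ofReal (2 * ‖p - x‖) * (ENNReal.ofReal (18 * Real.pi * P ^ (1 / 2 : ℝ)) *
        ENNReal.ofReal (X ^ (-(5 / 4) : ℝ) * ‖p - x‖⁻¹) * ∫⁻ s, Ψ s) := by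
    calc _ ≤ ENNReal.ofReal (2 * ‖p - x‖) * ∫⁻ y : R3, f (‖y‖ ^ 2) (‖p - x - y‖ ^ 2) := by
          gcongr with y
          exact h1 y
      _ = _ := lintegral_R3_bipolar f hfm (p - x) hxp
      _ ≤ ENNReal.ofReal Real.pi * ∫⁻ R : ℝ, ∫⁻ s : ℝ, f R s := by
          gcongr with R s
          exact Set.indicator_le_self _ _ _
      _ = ENNReal.ofReal Real.pi * ∫⁻ R : ℝ, (Set.Ici X).indicator
            (fun R => ENNReal.ofReal (K * R ^ (-(5 / 4) : ℝ))) R * ∫⁻ s, Ψ s := by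
          congr 1
          refine lintegral_congr fun R => ?_
          rw [hf]
          simp only
          rw [lintegral_const_mul _ (show Measurable fun s => Ψ (e₁ * X + e₂ * R + e₃ * s) from
              hΨ.comp (by fun_prop)),
            lintegral_comp_add_mul _ _ he]
      _ = _ := by
          rw [lintegral_mul_const _ (Measurable.indicator (by fun_prop) measurableSet_Ici),
            lintegral_indicator measurableSet_Ici, ← restrict_Ioi_eq_restrict_Ici]
          simp_rw [ENNReal.ofReal_mul hK0]
          rw [lintegral_const_mul' _ _ ENNReal.ofReal_ne_top,
            setLIntegral_Ioi_rpow (by norm_num) hX2, ← mul_assoc, ← mul_assoc, ← mul_assoc,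
            ← ENNReal.ofReal_mul Real.pi_pos.le, ← ENNReal.ofReal_mul (by positivity),
            ← ENNReal.ofReal_mul (by positivity), ← ENNReal.ofReal_mul (by positivity)]
          congr 2
          have e2 : X ^ (-(5 / 4) : ℝ) = X⁻¹ * X ^ (-(5 / 4) + 1 : ℝ) := by
            rw [← Real.rpow_neg_one, ← Real.rpow_add hX2]
            norm_num
          rw [hK, e2]
          field_simp
          ring
  exact (ENNReal.mul_le_mul_iff_right (by simpa using hA) ENNReal.ofReal_ne_top).1 h2

theorem lintegral_orderedIntegrand_le {Ψ : ℝ → ENNReal} (hΨ : Measurable Ψ) {e₁ e₂ e₃ : ℝ}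
    (he : e₃ = 1 ∨ e₃ = -1) {p : R3} (hp : p ≠ 0) :
    ∫⁻ x : R3, ∫⁻ y : R3, orderedIntegrand Ψ ‖p‖ e₁ e₂ e₃ x y (p - x - y) ≤
      ENNReal.ofReal (288 * Real.pi ^ 2) * ∫⁻ s, Ψ s := by
  have hP : 0 < ‖p‖ := norm_pos_iff.2 hp
  have hae : ∀ᵐ x : R3, x ≠ 0 ∧ p - x ≠ 0 := by
    have h1 : ∀ᵐ x : R3, x ≠ 0 := by simp [ae_iff]
    have h2 : ∀ᵐ x : R3, x ≠ p := by simp [ae_iff]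
    filter_upwards [h1, h2] with x hx hx'
    exact ⟨hx, sub_ne_zero.2 hx'.symm⟩
  have h2 : ENNReal.ofReal (2 * ‖p‖) *
      ∫⁻ x : R3, ∫⁻ y : R3, orderedIntegrand Ψ ‖p‖ e₁ e₂ e₃ x y (p - x - y) ≤
      ENNReal.ofReal (2 * ‖p‖) * (ENNReal.ofReal (288 * Real.pi ^ 2) * ∫⁻ s, Ψ s) := by
    calc _ ≤ ENNReal.ofReal (2 * ‖p‖) * ∫⁻ x : R3,
          ENNReal.ofReal (18 * Real.pi * ‖p‖ ^ (1 / 2 : ℝ)) *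
          ENNReal.ofReal ((‖x‖ ^ 2) ^ (-(5 / 4) : ℝ) * ‖p - x‖⁻¹) * ∫⁻ s, Ψ s := by
          refine mul_le_mul_right (lintegral_mono_ae ?_) _
          filter_upwards [hae] with x hx
          exact lintegral_orderedIntegrand_inner_le hΨ he hp hx.1 hx.2
      _ = ENNReal.ofReal (18 * Real.pi * ‖p‖ ^ (1 / 2 : ℝ)) * (ENNReal.ofReal (2 * ‖p‖) *
          ∫⁻ x : R3, ENNReal.ofReal ((‖x‖ ^ 2) ^ (-(5 / 4) : ℝ) * ‖p - x‖⁻¹)) * ∫⁻ s, Ψ s := by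
          rw [lintegral_mul_const _ (by fun_prop), lintegral_const_mul _ (by fun_prop)]
          ring
      _ ≤ ENNReal.ofReal (18 * Real.pi * ‖p‖ ^ (1 / 2 : ℝ)) *
          ENNReal.ofReal (32 * Real.pi * ‖p‖ ^ (1 / 2 : ℝ)) * ∫⁻ s, Ψ s := by
          gcongr
          exact lintegral_rpow_mul_inv_norm_sub_le p hp
      _ = _ := by
          rw [← mul_assoc, ← ENNReal.ofReal_mul (by positivity), ← ENNReal.ofReal_mul (by positivity)]
          congr 2
          have : ‖p‖ ^ (1 / 2 : ℝ) * ‖p‖ ^ (1 / 2 : ℝ) = ‖p‖ := by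
            rw [← Real.rpow_add hP]
            norm_num
          linear_combination 576 * Real.pi ^ 2 * this
  exact (ENNReal.mul_le_mul_iff_right (by simpa using hp) ENNReal.ofReal_ne_top).1 h2

theorem lintegral_swap₂₃ (G : R3 → R3 → R3 → ENNReal) (p : R3) :
    ∫⁻ x : R3, ∫⁻ y : R3, G x (p - x - y) y = ∫⁻ x : R3, ∫⁻ y : R3, G x y (p - x - y) := by
  refine lintegral_congr fun x => ?_
  rw [← lintegral_sub_left_eq_self (fun y => G x y (p - x - y)) (p - x)]
  simp

theorem lintegral_swap₁₂ {G : R3 → R3 → R3 → ENNReal}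
    (hG : Measurable fun q : R3 × R3 × R3 => G q.1 q.2.1 q.2.2) (p : R3) :
    ∫⁻ x : R3, ∫⁻ y : R3, G y x (p - x - y) = ∫⁻ x : R3, ∫⁻ y : R3, G x y (p - x - y) := by
  rw [lintegral_lintegral_swap (f := fun x y => G y x (p - x - y))]
  · simp_rw [sub_right_comm p]
  · exact (hG.comp (f := fun q : R3 × R3 => (q.2, q.1, p - q.1 - q.2)) (by fun_prop)).aemeasurable

theorem collapseIntegrand_le_sum (Ψ : ℝ → ENNReal) (P e₁ e₂ e₃ : ℝ) (x y z : R3) :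
    collapseIntegrand Ψ P e₁ e₂ e₃ x y z ≤
      orderedIntegrand Ψ P e₁ e₂ e₃ x y z + (orderedIntegrand Ψ P e₁ e₃ e₂ x z y +
        (orderedIntegrand Ψ P e₂ e₁ e₃ y x z + (orderedIntegrand Ψ P e₂ e₃ e₁ y z x +
        (orderedIntegrand Ψ P e₃ e₁ e₂ z x y + orderedIntegrand Ψ P e₃ e₂ e₁ z y x)))) := by
  simp only [orderedIntegrand]
  have p1 : collapseIntegrand Ψ P e₁ e₃ e₂ x z y = collapseIntegrand Ψ P e₁ e₂ e₃ x y z := by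
    simp only [collapseIntegrand]; ring_nf
  have p2 : collapseIntegrand Ψ P e₂ e₁ e₃ y x z = collapseIntegrand Ψ P e₁ e₂ e₃ x y z := by
    simp only [collapseIntegrand]; ring_nf
  have p3 : collapseIntegrand Ψ P e₂ e₃ e₁ y z x = collapseIntegrand Ψ P e₁ e₂ e₃ x y z := by
    simp only [collapseIntegrand]; ring_nf
  have p4 : collapseIntegrand Ψ P e₃ e₁ e₂ z x y = collapseIntegrand Ψ P e₁ e₂ e₃ x y z := by
    simp only [collapseIntegrand]; ring_nf
  have p5 : collapseIntegrand Ψ P e₃ e₂ e₁ z y x = collapseIntegrand Ψ P e₁ e₂ e₃ x y z := by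
    simp only [collapseIntegrand]; ring_nf
  rw [p1, p2, p3, p4, p5]
  set Q := collapseIntegrand Ψ P e₁ e₂ e₃ x y z
  rcases le_total ‖x‖ ‖y‖ with hxy | hxy <;> rcases le_total ‖y‖ ‖z‖ with hyz | hyz <;>
    rcases le_total ‖x‖ ‖z‖ with hxz | hxz
  · rw [if_pos ⟨hxy, hyz⟩]; exact le_self_add
  · rw [if_pos ⟨hxy, hyz⟩]; exact le_self_add
  · rw [if_pos (show ‖x‖ ≤ ‖z‖ ∧ ‖z‖ ≤ ‖y‖ from ⟨hxz, hyz⟩)]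
    exact le_self_add.trans le_add_self
  · rw [if_pos (show ‖z‖ ≤ ‖x‖ ∧ ‖x‖ ≤ ‖y‖ from ⟨hxz, hxy⟩)]
    exact le_self_add.trans (le_add_self.trans (le_add_self.trans (le_add_self.trans le_add_self)))
  · rw [if_pos (show ‖y‖ ≤ ‖x‖ ∧ ‖x‖ ≤ ‖z‖ from ⟨hxy, hxz⟩)]
    exact le_self_add.trans (le_add_self.trans le_add_self)
  · rw [if_pos (show ‖y‖ ≤ ‖z‖ ∧ ‖z‖ ≤ ‖x‖ from ⟨hyz, hxz⟩)]
    exact le_self_add.trans (le_add_self.trans (le_add_self.trans le_add_self))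
  · rw [if_pos (show ‖z‖ ≤ ‖y‖ ∧ ‖y‖ ≤ ‖x‖ from ⟨hyz, hxy⟩)]
    exact le_add_self.trans (le_add_self.trans (le_add_self.trans (le_add_self.trans le_add_self)))
  · rw [if_pos (show ‖z‖ ≤ ‖y‖ ∧ ‖y‖ ≤ ‖x‖ from ⟨hyz, hxy⟩)]
    exact le_add_self.trans (le_add_self.trans (le_add_self.trans (le_add_self.trans le_add_self)))

/-- The collapsing estimate in momentum space: under the weight `‖p‖² / (‖x‖² ‖y‖² ‖z‖²)` on the
plane `x + y + z = p`, the law of the phase `± ‖x‖² ± ‖y‖² ± ‖z‖²` has a density bounded uniformly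
in `p`. -/
theorem lintegral_collapseIntegrand_le {Ψ : ℝ → ENNReal} (hΨ : Measurable Ψ) {e₁ e₂ e₃ : ℝ}
    (h₁ : e₁ = 1 ∨ e₁ = -1) (h₂ : e₂ = 1 ∨ e₂ = -1) (h₃ : e₃ = 1 ∨ e₃ = -1) (p : R3) :
    ∫⁻ x : R3, ∫⁻ y : R3, collapseIntegrand Ψ ‖p‖ e₁ e₂ e₃ x y (p - x - y) ≤
      ENNReal.ofReal (1728 * Real.pi ^ 2) * ∫⁻ s, Ψ s := by
  rcases eq_or_ne p 0 with rfl | hp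
  · simp [collapseIntegrand]
  obtain ⟨H, hHdef⟩ : ∃ H, H = orderedIntegrand Ψ ‖p‖ := ⟨_, rfl⟩
  have hH : ∀ a b c, Measurable fun q : R3 × R3 × R3 => H a b c q.1 q.2.1 q.2.2 := by
    rw [hHdef]
    exact measurable_orderedIntegrand hΨ ‖p‖
  have hH' : ∀ a b c (u v w : R3 × R3 → R3), Measurable u → Measurable v → Measurable w →
      Measurable fun q : R3 × R3 => H a b c (u q) (v q) (w q) :=
    fun a b c u v w hu hv hw => (hH a b c).comp (hu.prodMk (hv.prodMk hw))
  have hle := collapseIntegrand_le_sum Ψ ‖p‖ e₁ e₂ e₃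
  rw [← hHdef] at hle
  obtain ⟨B, hB⟩ : ∃ B, B = ENNReal.ofReal (288 * Real.pi ^ 2) * ∫⁻ s, Ψ s := ⟨_, rfl⟩
  have hbase : ∀ a b c, (c = 1 ∨ c = -1) →
      ∫⁻ x : R3, ∫⁻ y : R3, H a b c x y (p - x - y) ≤ B := by
    intro a b c hc
    rw [hHdef, hB]
    exact lintegral_orderedIntegrand_le hΨ hc hp
  have b1 := hbase e₁ e₂ e₃ h₃
  have b2 : ∫⁻ x : R3, ∫⁻ y : R3, H e₁ e₃ e₂ x (p - x - y) y ≤ B :=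
    (lintegral_swap₂₃ (H e₁ e₃ e₂) p).trans_le (hbase _ _ _ h₂)
  have b3 : ∫⁻ x : R3, ∫⁻ y : R3, H e₂ e₁ e₃ y x (p - x - y) ≤ B :=
    (lintegral_swap₁₂ (hH e₂ e₁ e₃) p).trans_le (hbase _ _ _ h₃)
  have r₁ : ∀ a b c, ∫⁻ x : R3, ∫⁻ y : R3, H a b c y (p - x - y) x =
      ∫⁻ x : R3, ∫⁻ y : R3, H a b c x y (p - x - y) := fun a b c =>
    (lintegral_swap₁₂ (G := fun x y z => H a b c x z y)
      ((hH a b c).comp (f := fun q : R3 × R3 × R3 => (q.1, q.2.2, q.2.1)) (by fun_prop)) p).trans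
      (lintegral_swap₂₃ (H a b c) p)
  have b4 : ∫⁻ x : R3, ∫⁻ y : R3, H e₂ e₃ e₁ y (p - x - y) x ≤ B :=
    (r₁ e₂ e₃ e₁).trans_le (hbase _ _ _ h₁)
  have b5 : ∫⁻ x : R3, ∫⁻ y : R3, H e₃ e₁ e₂ (p - x - y) x y ≤ B :=
    ((lintegral_swap₂₃ (fun x y z => H e₃ e₁ e₂ y x z) p).trans
      (lintegral_swap₁₂ (hH e₃ e₁ e₂) p)).trans_le (hbase _ _ _ h₂)
  have b6 : ∫⁻ x : R3, ∫⁻ y : R3, H e₃ e₂ e₁ (p - x - y) y x ≤ B :=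
    ((lintegral_swap₂₃ (fun x y z => H e₃ e₂ e₁ y z x) p).trans
      (r₁ e₃ e₂ e₁)).trans_le (hbase _ _ _ h₁)
  have split : ∀ F F' : R3 → R3 → ENNReal, Measurable (fun q : R3 × R3 => F q.1 q.2) →
      ∫⁻ x : R3, ∫⁻ y : R3, (F x y + F' x y) =
        (∫⁻ x : R3, ∫⁻ y : R3, F x y) + ∫⁻ x : R3, ∫⁻ y : R3, F' x y := by
    intro F F' hF
    rw [← lintegral_add_left hF.lintegral_prod_right']
    refine lintegral_congr fun x => ?_
    exact lintegral_add_left (show Measurable fun y => F x y from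
      hF.comp (measurable_const.prodMk measurable_id)) _
  calc _ ≤ ∫⁻ x : R3, ∫⁻ y : R3, (H e₁ e₂ e₃ x y (p - x - y) + (H e₁ e₃ e₂ x (p - x - y) y +
      (H e₂ e₁ e₃ y x (p - x - y) + (H e₂ e₃ e₁ y (p - x - y) x +
        (H e₃ e₁ e₂ (p - x - y) x y + H e₃ e₂ e₁ (p - x - y) y x))))) :=
        lintegral_mono fun x => lintegral_mono fun y => hle x y _
    _ ≤ B + (B + (B + (B + (B + B)))) := by
        rw [split, split, split, split, split]
        · gcongr
        all_goals exact hH' _ _ _ _ _ _ (by fun_prop) (by fun_prop) (by fun_prop)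
    _ = _ := by
        rw [hB, show (1728 : ℝ) * Real.pi ^ 2 = 6 * (288 * Real.pi ^ 2) by ring,
          ENNReal.ofReal_mul (p := 6) (by norm_num)]
        norm_num
        ring

/-! ### Bounded families of Schwartz functions -/

/-- A family of Schwartz functions that is bounded in every Schwartz seminorm. -/
def SchwartzBounded {ι E : Type*} [NormedAddCommGroup E] [NormedSpace ℝ E]
    (φ : ι → 𝓢(E, ℂ)) : Prop :=
  ∀ k n : ℕ, ∃ C : ℝ, ∀ i, SchwartzMap.seminorm ℂ k n (φ i) ≤ C

namespace SchwartzBounded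

variable {ι E F : Type*} [NormedAddCommGroup E] [NormedSpace ℝ E]
  [NormedAddCommGroup F] [NormedSpace ℝ F]

theorem sup {φ : ι → 𝓢(E, ℂ)} (hφ : SchwartzBounded φ) (s : Finset (ℕ × ℕ)) :
    ∃ C : ℝ, 0 ≤ C ∧ ∀ i, s.sup (schwartzSeminormFamily ℂ E ℂ) (φ i) ≤ C := by
  choose C hC using hφ
  refine ⟨∑ m ∈ s, |C m.1 m.2|, Finset.sum_nonneg fun _ _ => abs_nonneg _, fun i => ?_⟩
  refine Seminorm.finset_sup_apply_le (Finset.sum_nonneg fun _ _ => abs_nonneg _) fun m hm => ?_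
  refine ((hC m.1 m.2 i).trans (le_abs_self _)).trans ?_
  exact Finset.single_le_sum (f := fun m : ℕ × ℕ => |C m.1 m.2|) (fun _ _ => abs_nonneg _) hm

theorem map {φ : ι → 𝓢(E, ℂ)} (hφ : SchwartzBounded φ) (L : 𝓢(E, ℂ) →L[ℂ] 𝓢(F, ℂ)) :
    SchwartzBounded fun i => L (φ i) := by
  intro k n
  let q : Seminorm ℂ 𝓢(E, ℂ) := (SchwartzMap.seminorm ℂ k n).comp L.toLinearMap
  have hq : Continuous q :=
    ((schwartz_withSeminorms ℂ F ℂ).continuous_seminorm (k, n)).comp L.continuous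
  obtain ⟨s, C, -, h⟩ := Seminorm.bound_of_continuous (schwartz_withSeminorms ℂ E ℂ) q hq
  obtain ⟨B, -, hB⟩ := hφ.sup s
  refine ⟨C * B, fun i => (h (φ i)).trans ?_⟩
  have : (C • s.sup (schwartzSeminormFamily ℂ E ℂ)) (φ i) =
    C * s.sup (schwartzSeminormFamily ℂ E ℂ) (φ i) := rfl
  rw [this]
  gcongr
  exact hB i

theorem apply {φ : ι → 𝓢(E, ℂ)} (hφ : SchwartzBounded φ) (T : 𝓢(E, ℂ) →L[ℂ] ℂ) :
    ∃ C : ℝ, ∀ i, ‖T (φ i)‖ ≤ C := by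
  let q : Seminorm ℂ 𝓢(E, ℂ) := (normSeminorm ℂ ℂ).comp T.toLinearMap
  have hq : Continuous q := continuous_norm.comp T.continuous
  obtain ⟨s, C, -, h⟩ := Seminorm.bound_of_continuous (schwartz_withSeminorms ℂ E ℂ) q hq
  obtain ⟨B, -, hB⟩ := hφ.sup s
  refine ⟨C * B, fun i => (h (φ i)).trans ?_⟩
  have : (C • s.sup (schwartzSeminormFamily ℂ E ℂ)) (φ i) =
    C * s.sup (schwartzSeminormFamily ℂ E ℂ) (φ i) := rfl
  rw [this]
  gcongr
  exact hB i

theorem decay {φ : ι → 𝓢(E, ℂ)} (hφ : SchwartzBounded φ) (N : ℕ) :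
    ∃ C : ℝ, 0 ≤ C ∧ ∀ i x, ‖φ i x‖ ≤ C * ((1 + ‖x‖) ^ N)⁻¹ := by
  obtain ⟨B, hB0, hB⟩ := hφ.sup (Finset.Iic (N, 0))
  refine ⟨2 ^ N * B, by positivity, fun i x => ?_⟩
  have h := one_add_le_sup_seminorm_apply (𝕜 := ℂ) (m := (N, 0)) (k := N) (n := 0) le_rfl le_rfl (φ i) x
  rw [norm_iteratedFDeriv_zero] at h
  rw [← div_eq_mul_inv, le_div_iff₀ (by positivity), mul_comm]
  refine h.trans ?_
  gcongr
  exact hB i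

theorem of_single (φ : 𝓢(E, ℂ)) : SchwartzBounded fun _ : Unit => φ :=
  fun k n => ⟨SchwartzMap.seminorm ℂ k n φ, fun _ => le_rfl⟩

theorem summable_smul {φ : ι → 𝓢(E, ℂ)} (hφ : SchwartzBounded φ) (a : lp (fun _ : ι => ℂ) 1) (x : E) :
    Summable fun i => a i * φ i x := by
  obtain ⟨C, hC0, hC⟩ := hφ.decay 0
  have ha : Summable fun i => ‖a i‖ := by simpa using (lp.hasSum_norm (by norm_num) a).summable
  refine Summable.of_norm_bounded (ha.mul_right C) fun i => ?_
  rw [norm_mul]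
  gcongr
  simpa using hC i x

/-- The Schwartz function `∑ᵢ aᵢ φᵢ`, for an absolutely summable family of coefficients. -/
theorem exists_tsum {φ : ι → 𝓢(E, ℂ)} (hφ : SchwartzBounded φ) :
    ∃ L : lp (fun _ : ι => ℂ) 1 →ₗ[ℂ] 𝓢(E, ℂ), (∀ a x, L a x = ∑' i, a i * φ i x) ∧
      ∀ k n, ∃ C, 0 ≤ C ∧ ∀ a, SchwartzMap.seminorm ℂ k n (L a) ≤ C * ‖a‖ := by
  choose C hC using hφ
  have hnorm : ∀ a : lp (fun _ : ι => ℂ) 1, HasSum (fun i => ‖a i‖) ‖a‖ := fun a => by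
    simpa using lp.hasSum_norm (by norm_num) a
  have hbd' : ∀ (c : ℂ) (k n : ℕ) i x,
      ‖x‖ ^ k * ‖iteratedFDeriv ℝ n (fun y => c * φ i y) x‖ ≤ ‖c‖ * |C k n| := by
    intro c k n i x
    have e : iteratedFDeriv ℝ n (fun y => c * φ i y) x = c • iteratedFDeriv ℝ n (φ i) x := by
      change iteratedFDeriv ℝ n (c • (φ i : E → ℂ)) x = _
      exact iteratedFDeriv_const_smul_apply ((φ i).smooth n).contDiffAt
    rw [e, norm_smul, mul_left_comm]
    gcongr
    exact ((SchwartzMap.le_seminorm ℂ k n (φ i) x).trans (hC k n i)).trans (le_abs_self _)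
  have hbd : ∀ (a : lp (fun _ : ι => ℂ) 1) (k n : ℕ) i x,
      ‖x‖ ^ k * ‖iteratedFDeriv ℝ n (fun y => a i * φ i y) x‖ ≤ ‖a i‖ * |C k n| :=
    fun a k n i x => hbd' (a i) k n i x
  have hsm : ∀ (a : lp (fun _ : ι => ℂ) 1) i, ContDiff ℝ (⊤ : ℕ∞) fun y => a i * φ i y :=
    fun a i => contDiff_const.mul ((φ i).smooth _)
  have hsum : ∀ (a : lp (fun _ : ι => ℂ) 1) (k : ℕ), Summable fun i => ‖a i‖ * |C 0 k| :=
    fun a k => (hnorm a).summable.mul_right _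
  have hbd0 : ∀ (a : lp (fun _ : ι => ℂ) 1) (n : ℕ) i x,
      ‖iteratedFDeriv ℝ n (fun y => a i * φ i y) x‖ ≤ ‖a i‖ * |C 0 n| := by
    intro a n i x
    simpa using hbd a 0 n i x
  have hmain : ∀ (a : lp (fun _ : ι => ℂ) 1) (k n : ℕ) x,
      ‖x‖ ^ k * ‖iteratedFDeriv ℝ n (fun y => ∑' i, a i * φ i y) x‖ ≤ |C k n| * ‖a‖ := by
    intro a k n x
    rw [iteratedFDeriv_tsum (N := (⊤ : ℕ∞)) (v := fun n i => ‖a i‖ * |C 0 n|) (hsm a)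
      (fun n _ => hsum a n) (fun n i x _ => hbd0 a n i x) (by exact_mod_cast le_top)]
    have hs : Summable fun i => ‖iteratedFDeriv ℝ n (fun y => a i * φ i y) x‖ :=
      Summable.of_nonneg_of_le (fun _ => norm_nonneg _) (fun i => hbd0 a n i x) (hsum a n)
    calc _ ≤ ‖x‖ ^ k * ∑' i, ‖iteratedFDeriv ℝ n (fun y => a i * φ i y) x‖ := by
          gcongr
          exact norm_tsum_le_tsum_norm hs
      _ = ∑' i, ‖x‖ ^ k * ‖iteratedFDeriv ℝ n (fun y => a i * φ i y) x‖ := tsum_mul_left.symm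
      _ ≤ ∑' i, ‖a i‖ * |C k n| :=
          (hs.mul_left _).tsum_le_tsum (fun i => hbd a k n i x) ((hnorm a).summable.mul_right _)
      _ = |C k n| * ‖a‖ := by rw [tsum_mul_right, (hnorm a).tsum_eq, mul_comm]
  have hφ' : SchwartzBounded φ := fun k n => ⟨C k n, hC k n⟩
  refine ⟨{ toFun := fun a =>
              { toFun := fun x => ∑' i, a i * φ i x
                smooth' := contDiff_tsum (v := fun n i => ‖a i‖ * |C 0 n|) (hsm a)
                  (fun n _ => hsum a n) (fun n i x _ => hbd0 a n i x)
                decay' := fun k n => ⟨_, hmain a k n⟩ }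
            map_add' := fun a b => ?_
            map_smul' := fun c a => ?_ }, fun a x => rfl, fun k n => ⟨|C k n|, abs_nonneg _,
              fun a => SchwartzMap.seminorm_le_bound ℂ k n _ (by positivity) (hmain a k n)⟩⟩
  · ext x
    change ∑' i, (a + b : lp (fun _ : ι => ℂ) 1) i * φ i x = (∑' i, a i * φ i x) + ∑' i, b i * φ i x
    rw [← (hφ'.summable_smul a x).tsum_add (hφ'.summable_smul b x)]
    simp [add_mul]
  · ext x
    change ∑' i, (c • a : lp (fun _ : ι => ℂ) 1) i * φ i x = c • ∑' i, a i * φ i x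
    rw [smul_eq_mul, ← tsum_mul_left]
    simp [mul_assoc]

/-- Uniform boundedness on Schwartz space: a pointwise bounded family of tempered distributions is
bounded on every bounded family of Schwartz functions. The Banach space on which the
Banach–Steinhaus theorem is applied is `ℓ¹`, mapped to Schwartz space by `a ↦ ∑ᵢ aᵢ φᵢ`. -/
theorem uniform_bound {σ : Type*} {φ : ι → 𝓢(E, ℂ)} (hφ : SchwartzBounded φ)
    (T : σ → 𝓢(E, ℂ) →L[ℂ] ℂ) (hT : ∀ ψ, ∃ C : ℝ, ∀ s, ‖T s ψ‖ ≤ C) :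
    ∃ C : ℝ, ∀ s i, ‖T s (φ i)‖ ≤ C := by
  classical
  obtain ⟨L, hL, hLb⟩ := hφ.exists_tsum
  have hball : SchwartzBounded fun a : Metric.closedBall (0 : lp (fun _ : ι => ℂ) 1) 1 => L a := by
    intro k n
    obtain ⟨C, hC0, hC⟩ := hLb k n
    refine ⟨C, fun a => (hC a).trans ?_⟩
    have : ‖(a : lp (fun _ : ι => ℂ) 1)‖ ≤ 1 := mem_closedBall_zero_iff.1 a.2
    nlinarith
  have hcont : ∀ s, ∃ g : lp (fun _ : ι => ℂ) 1 →L[ℂ] ℂ, ∀ a, g a = T s (L a) := by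
    intro s
    obtain ⟨C, hC⟩ := hball.apply (T s)
    refine ⟨((T s).toLinearMap.comp L).mkContinuous (max C 0) fun a => ?_, fun a => rfl⟩
    change ‖T s (L a)‖ ≤ _
    rcases eq_or_ne a 0 with rfl | ha
    · simp
    have ha' : 0 < ‖a‖ := norm_pos_iff.2 ha
    have h := hC ⟨((‖a‖⁻¹ : ℝ) : ℂ) • a, by
      rw [mem_closedBall_zero_iff, norm_smul]
      simp [ha'.ne']⟩
    simp only [map_smul, norm_smul] at h
    rw [Complex.norm_real, norm_inv, norm_norm, inv_mul_le_iff₀ ha'] at h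
    calc _ ≤ ‖a‖ * C := h
      _ ≤ max C 0 * ‖a‖ := by
        rw [mul_comm]
        gcongr
        exact le_max_left _ _
  choose g hg using hcont
  obtain ⟨C, hC⟩ := banach_steinhaus (g := g) fun a => by
    obtain ⟨B, hB⟩ := hT (L a)
    exact ⟨B, fun s => by rw [hg]; exact hB s⟩
  refine ⟨C, fun s i => ?_⟩
  have h1 : L (lp.single 1 i 1) = φ i := by
    ext x
    rw [hL, tsum_eq_single i]
    · simp
    · intro j hj
      simp [hj]
  rw [← h1, ← hg]
  refine ((g s).le_opNorm _).trans ?_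
  rw [lp.norm_single (by norm_num)]
  simpa using hC s

end SchwartzBounded

theorem TemperedFun.aestronglyMeasurable {V : Type*} [NormedAddCommGroup V] [MeasureSpace V]
    [OpensMeasurableSpace V] [SecondCountableTopology V] {g : V → ℂ} (hg : TemperedFun g) :
    AEStronglyMeasurable g volume := by
  obtain ⟨N, hN⟩ := hg
  have h : AEStronglyMeasurable (fun x : V => ((1 + ‖x‖) ^ N : ℝ)) volume :=
    (by fun_prop : Continuous fun x : V => ((1 + ‖x‖) ^ N : ℝ)).aestronglyMeasurable
  refine (h.smul hN.aestronglyMeasurable).congr (Eventually.of_forall fun x => ?_)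
  simp only [Pi.smul_apply', smul_smul]
  rw [mul_inv_cancel₀ (by positivity), one_smul]

/-- Integration against a tempered function is a continuous functional on Schwartz space. -/
theorem TemperedFun.exists_clm {V : Type*} [NormedAddCommGroup V] [NormedSpace ℝ V] [MeasureSpace V]
    [OpensMeasurableSpace V] [SecondCountableTopology V]
    {g : V → ℂ} (hg : TemperedFun g) :
    (∀ φ : 𝓢(V, ℂ), Integrable fun x => g x * φ x) ∧
    ∃ T : 𝓢(V, ℂ) →L[ℂ] ℂ, ∀ φ, T φ = ∫ x, g x * φ x := by
  have hgm := hg.aestronglyMeasurable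
  obtain ⟨N, hN⟩ := hg
  have hw : ∀ x : V, (0 : ℝ) < (1 + ‖x‖) ^ N := fun x => by positivity
  set I := ∫ x, ‖(((1 + ‖x‖) ^ N)⁻¹ : ℝ) • g x‖ with hI
  have hbd : ∀ (φ : 𝓢(V, ℂ)) x, ‖g x * φ x‖ ≤
      ‖(((1 + ‖x‖) ^ N)⁻¹ : ℝ) • g x‖ * (2 ^ N * (Finset.Iic (N, 0)).sup (schwartzSeminormFamily ℂ V ℂ) φ) := by
    intro φ x
    have h := one_add_le_sup_seminorm_apply (𝕜 := ℂ) (m := (N, 0)) (k := N) (n := 0) le_rfl le_rfl φ x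
    rw [norm_iteratedFDeriv_zero] at h
    rw [norm_smul, norm_mul, norm_inv, Real.norm_of_nonneg (hw x).le]
    calc ‖g x‖ * ‖φ x‖ = ((1 + ‖x‖) ^ N)⁻¹ * ‖g x‖ * ((1 + ‖x‖) ^ N * ‖φ x‖) := by
          field_simp [(hw x).ne']
      _ ≤ _ := by
          refine mul_le_mul_of_nonneg_left h (by positivity)
  have hint : ∀ φ : 𝓢(V, ℂ), Integrable fun x => g x * φ x := fun φ =>
    (hN.norm.mul_const _).mono' (hgm.mul φ.continuous.aestronglyMeasurable)
      (Eventually.of_forall fun x => hbd φ x)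
  refine ⟨hint, SchwartzMap.mkCLMtoNormedSpace (fun φ => ∫ x, g x * φ x) (fun φ ψ => ?_)
    (fun c φ => ?_) ⟨Finset.Iic (N, 0), I * 2 ^ N, by positivity, fun φ => ?_⟩, fun φ => rfl⟩
  · rw [← integral_add (hint φ) (hint ψ)]
    simp [mul_add]
  · simp only [RingHom.id_apply, smul_eq_mul]
    rw [← integral_const_mul]
    simp [mul_left_comm]
  · refine (norm_integral_le_of_norm_le (hN.norm.mul_const _)
      (Eventually.of_forall fun x => hbd φ x)).trans ?_
    rw [integral_mul_const, mul_assoc]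

/-! ### Products and time slices of Schwartz functions -/

theorem ContinuousLinearMap.norm_iteratedFDeriv_schwartz_comp_le {E F : Type*}
    [NormedAddCommGroup E] [NormedSpace ℝ E] [NormedAddCommGroup F] [NormedSpace ℝ F]
    (L : E →L[ℝ] F) (f : 𝓢(F, ℂ)) (n : ℕ) (z : E) :
    ‖iteratedFDeriv ℝ n (fun z => f (L z)) z‖ ≤ ‖L‖ ^ n * ‖iteratedFDeriv ℝ n f (L z)‖ := by
  have h := L.iteratedFDeriv_comp_right (f.smooth n) z le_rfl
  have h' : (f : F → ℂ) ∘ L = fun z => f (L z) := rfl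
  rw [← h', h, mul_comm]
  refine (ContinuousMultilinearMap.norm_compContinuousLinearMap_le _ _).trans ?_
  simp

/-- The product of two Schwartz functions of linear images `L₁ z`, `L₂ z` is a Schwartz function of
`z` as soon as these two images control `z`. -/
theorem SchwartzMap.exists_mul_comp {E E₁ E₂ : Type*} [NormedAddCommGroup E] [NormedSpace ℝ E]
    [NormedAddCommGroup E₁] [NormedSpace ℝ E₁] [NormedAddCommGroup E₂] [NormedSpace ℝ E₂]
    (L₁ : E →L[ℝ] E₁) (L₂ : E →L[ℝ] E₂) {C : ℝ} (hC : ∀ z, ‖z‖ ≤ C * (‖L₁ z‖ + ‖L₂ z‖))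
    (f : 𝓢(E₁, ℂ)) (g : 𝓢(E₂, ℂ)) : ∃ Φ : 𝓢(E, ℂ), ∀ z, Φ z = f (L₁ z) * g (L₂ z) := by
  have hf : ContDiff ℝ (⊤ : ℕ∞) fun z => f (L₁ z) := (f.smooth _).comp L₁.contDiff
  have hg : ContDiff ℝ (⊤ : ℕ∞) fun z => g (L₂ z) := (g.smooth _).comp L₂.contDiff
  refine ⟨⟨fun z => f (L₁ z) * g (L₂ z), hf.mul hg, fun k n => ?_⟩, fun z => rfl⟩
  set A := ((Finset.Iic (k, n)).sup fun m => SchwartzMap.seminorm ℂ m.1 m.2) f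
  set B := ((Finset.Iic (k, n)).sup fun m => SchwartzMap.seminorm ℂ m.1 m.2) g
  have hA : ∀ i ≤ n, ∀ x, (1 + ‖x‖) ^ k * ‖iteratedFDeriv ℝ i f x‖ ≤ 2 ^ k * A := fun i hi x =>
    one_add_le_sup_seminorm_apply (𝕜 := ℂ) (m := (k, n)) le_rfl hi f x
  have hB : ∀ i ≤ n, ∀ x, (1 + ‖x‖) ^ k * ‖iteratedFDeriv ℝ i g x‖ ≤ 2 ^ k * B := fun i hi x =>
    one_add_le_sup_seminorm_apply (𝕜 := ℂ) (m := (k, n)) le_rfl hi g x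
  refine ⟨∑ i ∈ Finset.range (n + 1), |C| ^ k * (n.choose i * (‖L₁‖ ^ i * ‖L₂‖ ^ (n - i)) *
    ((2 ^ k * A) * (2 ^ k * B))), fun z => ?_⟩
  have hz : ‖z‖ ≤ |C| * ((1 + ‖L₁ z‖) * (1 + ‖L₂ z‖)) := by
    refine (hC z).trans ?_
    calc C * (‖L₁ z‖ + ‖L₂ z‖) ≤ |C| * (‖L₁ z‖ + ‖L₂ z‖) := by
          gcongr
          exact le_abs_self C
      _ ≤ _ := by
          gcongr
          nlinarith [norm_nonneg (L₁ z), norm_nonneg (L₂ z),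
            mul_nonneg (norm_nonneg (L₁ z)) (norm_nonneg (L₂ z))]
  have hmul := norm_iteratedFDeriv_mul_le (n := n) hf hg z (by exact_mod_cast le_top)
  calc ‖z‖ ^ k * _ ≤ (|C| * ((1 + ‖L₁ z‖) * (1 + ‖L₂ z‖))) ^ k * _ := by gcongr
    _ ≤ (|C| * ((1 + ‖L₁ z‖) * (1 + ‖L₂ z‖))) ^ k * _ := by gcongr
    _ = ∑ i ∈ Finset.range (n + 1), (|C| * ((1 + ‖L₁ z‖) * (1 + ‖L₂ z‖))) ^ k * _ :=
        Finset.mul_sum _ _ _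
    _ ≤ _ := by
      refine Finset.sum_le_sum fun i hi => ?_
      have hi' : i ≤ n := Nat.lt_succ_iff.1 (Finset.mem_range.1 hi)
      have h1 := L₁.norm_iteratedFDeriv_schwartz_comp_le f i z
      have h2 := L₂.norm_iteratedFDeriv_schwartz_comp_le g (n - i) z
      calc _ ≤ (|C| * ((1 + ‖L₁ z‖) * (1 + ‖L₂ z‖))) ^ k * (n.choose i *
            (‖L₁‖ ^ i * ‖iteratedFDeriv ℝ i f (L₁ z)‖) *
            (‖L₂‖ ^ (n - i) * ‖iteratedFDeriv ℝ (n - i) g (L₂ z)‖)) := by gcongr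
        _ = |C| ^ k * (n.choose i * (‖L₁‖ ^ i * ‖L₂‖ ^ (n - i)) *
            (((1 + ‖L₁ z‖) ^ k * ‖iteratedFDeriv ℝ i f (L₁ z)‖) *
            ((1 + ‖L₂ z‖) ^ k * ‖iteratedFDeriv ℝ (n - i) g (L₂ z)‖))) := by
            rw [mul_pow, mul_pow]
            ring
        _ ≤ _ := by
            refine mul_le_mul_of_nonneg_left (mul_le_mul_of_nonneg_left ?_ (by positivity))
              (by positivity)
            exact mul_le_mul (hA i hi' _) (hB (n - i) (Nat.sub_le n i) _) (by positivity)
              ((by positivity : (0 : ℝ) ≤ (1 + ‖L₁ z‖) ^ k * ‖iteratedFDeriv ℝ i f (L₁ z)‖).trans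
                (hA i hi' _))

section Slice

variable {V : Type*} [NormedAddCommGroup V] [NormedSpace ℝ V]

variable (V) in
/-- The inclusion of space into space-time at time `0`. -/
def spaceInclusion : V →L[ℝ] WithLp 2 (ℝ × V) :=
  (WithLp.prodContinuousLinearEquiv 2 ℝ ℝ V).symm.toContinuousLinearMap.comp
    (ContinuousLinearMap.inr ℝ ℝ V)

theorem toLp_eq_spaceInclusion_add (t : ℝ) (v : V) :
    (WithLp.toLp 2 (t, v) : WithLp 2 (ℝ × V)) = spaceInclusion V v + WithLp.toLp 2 (t, 0) := by
  change _ = WithLp.toLp 2 ((0 : ℝ), v) + WithLp.toLp 2 (t, (0 : V))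
  rw [← WithLp.toLp_add]
  simp

theorem norm_spaceInclusion_le : ‖spaceInclusion V‖ ≤ 1 := by
  refine ContinuousLinearMap.opNorm_le_bound _ zero_le_one fun v => ?_
  change ‖(WithLp.toLp 2 ((0 : ℝ), v) : WithLp 2 (ℝ × V))‖ ≤ _
  rw [WithLp.prod_norm_eq_of_L2]
  simp

/-- The restriction `Φ(t, ·)` of a Schwartz function on space-time to a time `t`. -/
def SchwartzMap.slice (t : ℝ) : 𝓢(WithLp 2 (ℝ × V), ℂ) →L[ℂ] 𝓢(V, ℂ) :=
  SchwartzMap.compCLM ℂ (g := fun v : V => (WithLp.toLp 2 (t, v) : WithLp 2 (ℝ × V)))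
    (by
      rw [show (fun v : V => (WithLp.toLp 2 (t, v) : WithLp 2 (ℝ × V))) =
        fun v => spaceInclusion V v + WithLp.toLp 2 (t, 0) from
        funext (toLp_eq_spaceInclusion_add t)]
      exact (ContinuousLinearMap.hasTemperateGrowth _).add (Function.HasTemperateGrowth.const _))
    ⟨1, 1, fun v => by
      rw [pow_one, one_mul]
      refine le_trans ?_ (le_add_of_nonneg_left zero_le_one)
      exact WithLp.norm_snd_le (p := 2) (x := (WithLp.toLp 2 (t, v) : WithLp 2 (ℝ × V)))⟩

@[simp]
theorem SchwartzMap.slice_apply (t : ℝ) (Φ : 𝓢(WithLp 2 (ℝ × V), ℂ)) (v : V) :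
    slice t Φ v = Φ (WithLp.toLp 2 (t, v)) := rfl

theorem SchwartzMap.norm_iteratedFDeriv_slice_le (Φ : 𝓢(WithLp 2 (ℝ × V), ℂ)) (n : ℕ) (t : ℝ) (v : V) :
    ‖iteratedFDeriv ℝ n (slice t Φ) v‖ ≤ ‖iteratedFDeriv ℝ n Φ (WithLp.toLp 2 (t, v))‖ := by
  set c : WithLp 2 (ℝ × V) := WithLp.toLp 2 (t, 0)
  have hs : ContDiff ℝ n fun z => Φ (z + c) := (Φ.smooth n).comp (contDiff_id.add contDiff_const)
  have h := (spaceInclusion V).iteratedFDeriv_comp_right hs v le_rfl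
  have h' : (fun z => Φ (z + c)) ∘ spaceInclusion V = slice t Φ := by
    ext v
    simp only [Function.comp, slice_apply, toLp_eq_spaceInclusion_add t v]
    rfl
  rw [← h', h, iteratedFDeriv_comp_add_right, ← toLp_eq_spaceInclusion_add]
  refine (ContinuousMultilinearMap.norm_compContinuousLinearMap_le _ _).trans ?_
  refine mul_le_of_le_one_right (norm_nonneg _) ?_
  exact Finset.prod_le_one (fun _ _ => norm_nonneg _) fun _ _ => norm_spaceInclusion_le

/-- The time slices decay in time in every seminorm, here at the integrable rate `(1 + t²)⁻¹`. -/
theorem SchwartzMap.slice_bounded (Φ : 𝓢(WithLp 2 (ℝ × V), ℂ)) :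
    SchwartzBounded fun t : ℝ => ((1 + t ^ 2 : ℝ) : ℂ) • slice t Φ := by
  intro k n
  have hb := fun z => one_add_le_sup_seminorm_apply (𝕜 := ℂ) (m := (k + 2, n)) (k := k + 2) (n := n)
    le_rfl le_rfl Φ z
  set B := ((Finset.Iic (k + 2, n)).sup fun m => SchwartzMap.seminorm ℂ m.1 m.2) Φ
  refine ⟨2 ^ (k + 2) * B, fun t => ?_⟩
  rw [map_smul_eq_mul, Complex.norm_real, Real.norm_of_nonneg (by positivity),
    ← le_div_iff₀' (by positivity)]
  have hB : 0 ≤ 2 ^ (k + 2) * B := le_trans (by positivity) (hb 0)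
  refine SchwartzMap.seminorm_le_bound ℂ k n _ (by positivity) fun v => ?_
  rw [le_div_iff₀' (by positivity)]
  set z : WithLp 2 (ℝ × V) := WithLp.toLp 2 (t, v) with hz
  have ht : |t| ≤ ‖z‖ := WithLp.norm_fst_le (p := 2) (x := z)
  have hv : ‖v‖ ≤ ‖z‖ := WithLp.norm_snd_le (p := 2) (x := z)
  have h1 : 1 + t ^ 2 ≤ (1 + ‖z‖) ^ 2 := by
    nlinarith [sq_abs t, abs_nonneg t, norm_nonneg z]
  calc (1 + t ^ 2) * (‖v‖ ^ k * ‖iteratedFDeriv ℝ n (slice t Φ) v‖)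
      ≤ (1 + ‖z‖) ^ 2 * ((1 + ‖z‖) ^ k * ‖iteratedFDeriv ℝ n Φ z‖) := by
        gcongr
        · linarith
        · exact norm_iteratedFDeriv_slice_le Φ n t v
    _ = (1 + ‖z‖) ^ (k + 2) * ‖iteratedFDeriv ℝ n Φ z‖ := by ring
    _ ≤ _ := hb z

theorem SchwartzMap.slice_bounded' (Φ : 𝓢(WithLp 2 (ℝ × V), ℂ)) :
    SchwartzBounded fun t : ℝ => slice t Φ := by
  intro k n
  obtain ⟨C, hC⟩ := slice_bounded Φ k n
  refine ⟨C, fun t => le_trans ?_ (hC t)⟩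
  rw [map_smul_eq_mul, Complex.norm_real, Real.norm_of_nonneg (by positivity)]
  exact le_mul_of_one_le_left (apply_nonneg _ _) (by nlinarith [sq_nonneg t])

end Slice

theorem hasTemperateGrowth_exp_mul_I :
    Function.HasTemperateGrowth fun x : ℝ => Complex.exp (x * Complex.I) := by
  have hd : ∀ n : ℕ, iteratedDeriv n (fun x : ℝ => Complex.exp (x * Complex.I)) =
      fun x : ℝ => Complex.I ^ n * Complex.exp (x * Complex.I) := by
    intro n
    induction n with
    | zero => ext x; simp
    | succ n ih =>
      rw [iteratedDeriv_succ, ih]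
      ext x
      have h1 : HasDerivAt (fun x : ℝ => (x : ℂ) * Complex.I) (1 * Complex.I) x :=
        (Complex.ofRealCLM.hasDerivAt (x := x)).mul_const Complex.I
      have h2 := (h1.cexp.const_mul (Complex.I ^ n)).deriv
      rw [h2]
      ring
  refine ⟨?_, fun n => ⟨0, 1, fun x => ?_⟩⟩
  · exact Complex.contDiff_exp.comp (Complex.ofRealCLM.contDiff.mul contDiff_const)
  · rw [norm_iteratedFDeriv_eq_norm_iteratedDeriv, hd]
    simp [Complex.norm_exp_ofReal_mul_I]

theorem norm_le_norm_fst_add_norm_snd {V : Type*} [NormedAddCommGroup V]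
    (z : WithLp 2 (ℝ × V)) : ‖z‖ ≤ ‖z.fst‖ + ‖z.snd‖ := by
  rw [WithLp.prod_norm_eq_of_L2]
  refine Real.sqrt_le_iff.2 ⟨by positivity, ?_⟩
  nlinarith [mul_nonneg (norm_nonneg z.fst) (norm_nonneg z.snd)]

section Phase

variable {V : Type*} [NormedAddCommGroup V] [NormedSpace ℝ V]

theorem hasTemperateGrowth_exp_phase {θ : V → ℝ} (hθ : θ.HasTemperateGrowth) (τ : ℝ) :
    Function.HasTemperateGrowth fun v => Complex.exp ((τ * θ v : ℝ) * Complex.I) :=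
  hasTemperateGrowth_exp_mul_I.comp ((Function.HasTemperateGrowth.const τ).mul hθ)

theorem hasTemperateGrowth_ofReal_comp {θ : V → ℝ} (hθ : θ.HasTemperateGrowth) :
    Function.HasTemperateGrowth fun v => (θ v : ℂ) :=
  Complex.ofRealCLM.hasTemperateGrowth.comp hθ

/-- Multiplication of a Schwartz function by the phase `exp(i τ θ)`. -/
def phaseMul (θ : V → ℝ) (τ : ℝ) : 𝓢(V, ℂ) →L[ℂ] 𝓢(V, ℂ) :=
  smulLeftCLM ℂ fun v => Complex.exp ((τ * θ v : ℝ) * Complex.I)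

/-- Multiplication of a Schwartz function by the real symbol `θ`. -/
def symbolMul (θ : V → ℝ) : 𝓢(V, ℂ) →L[ℂ] 𝓢(V, ℂ) :=
  smulLeftCLM ℂ fun v => (θ v : ℂ)

theorem phaseMul_apply {θ : V → ℝ} (hθ : θ.HasTemperateGrowth) (τ : ℝ) (g : 𝓢(V, ℂ)) (v : V) :
    phaseMul θ τ g v = Complex.exp ((τ * θ v : ℝ) * Complex.I) * g v :=
  smulLeftCLM_apply_apply (hasTemperateGrowth_exp_phase hθ τ) g v

theorem symbolMul_apply {θ : V → ℝ} (hθ : θ.HasTemperateGrowth) (g : 𝓢(V, ℂ)) (v : V) :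
    symbolMul θ g v = θ v * g v :=
  smulLeftCLM_apply_apply (hasTemperateGrowth_ofReal_comp hθ) g v

theorem symbolMul_phaseMul {θ : V → ℝ} (hθ : θ.HasTemperateGrowth) (τ : ℝ) (g : 𝓢(V, ℂ)) :
    symbolMul θ (phaseMul θ τ g) = phaseMul θ τ (symbolMul θ g) := by
  ext v
  rw [symbolMul_apply hθ, phaseMul_apply hθ, phaseMul_apply hθ, symbolMul_apply hθ]
  ring

/-- The functions `exp(i τ θ) g`, for `τ` in a bounded interval, form a bounded family: up to a
cutoff in `τ` they are the time slices of one Schwartz function on space-time. -/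
theorem phaseMul_bounded {θ : V → ℝ} (hθ : θ.HasTemperateGrowth) (R : ℝ) (g : 𝓢(V, ℂ)) :
    SchwartzBounded fun τ : Set.Icc (-R) R => phaseMul θ τ g := by
  rcases lt_or_ge R 0 with hR | hR
  · exact fun k n => ⟨0, fun τ => absurd (τ.2.1.trans τ.2.2) (by linarith)⟩
  let η : ContDiffBump (0 : ℝ) := ⟨R + 1, R + 2, by linarith, by linarith⟩
  have hηs : HasCompactSupport fun x => (η x : ℂ) :=
    η.hasCompactSupport.comp_left (g := fun x : ℝ => (x : ℂ)) Complex.ofReal_zero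
  have hηd : ContDiff ℝ (⊤ : ℕ∞) fun x => (η x : ℂ) := Complex.ofRealCLM.contDiff.comp η.contDiff
  obtain ⟨H, hH⟩ := SchwartzMap.exists_mul_comp (WithLp.fstL 2 ℝ ℝ V) (WithLp.sndL 2 ℝ ℝ V)
    (C := 1) (fun z => by rw [one_mul]; exact norm_le_norm_fst_add_norm_snd z)
    (hηs.toSchwartzMap hηd) g
  have hE : Function.HasTemperateGrowth fun z : WithLp 2 (ℝ × V) =>
      Complex.exp ((z.fst * θ z.snd : ℝ) * Complex.I) :=
    hasTemperateGrowth_exp_mul_I.comp ((WithLp.fstL 2 ℝ ℝ V).hasTemperateGrowth.mul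
      (hθ.comp (WithLp.sndL 2 ℝ ℝ V).hasTemperateGrowth))
  have hb := SchwartzMap.slice_bounded' (smulLeftCLM ℂ
    (fun z : WithLp 2 (ℝ × V) => Complex.exp ((z.fst * θ z.snd : ℝ) * Complex.I)) H)
  intro k n
  obtain ⟨C, hC⟩ := hb k n
  refine ⟨C, fun τ => ?_⟩
  convert hC τ using 2
  ext v
  rw [phaseMul_apply hθ, SchwartzMap.slice_apply, smulLeftCLM_apply_apply hE, hH]
  have h1 : η τ = 1 := η.one_of_mem_closedBall (by
    rw [mem_closedBall_zero_iff, Real.norm_eq_abs, abs_le]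
    change -(R + 1) ≤ _ ∧ _ ≤ R + 1
    exact ⟨by linarith [τ.2.1], by linarith [τ.2.2]⟩)
  have h2 : (hηs.toSchwartzMap hηd) ((WithLp.fstL 2 ℝ ℝ V)
      (WithLp.toLp 2 ((τ : ℝ), v) : WithLp 2 (ℝ × V))) = ((η τ : ℝ) : ℂ) := rfl
  rw [h2, h1]
  simp

end Phase

/-! ### Uniqueness for weak solutions of multiplier equations -/

/-- A function `u(s, τ)` with equal partial derivatives is constant along `s + τ = t`. Joint
continuity of the derivatives is not assumed: a locally bounded second derivative in `τ` and
separate continuity in `s` suffice. -/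
theorem eq_of_partialDeriv_eq {u u₁ u₂ : ℝ → ℝ → ℂ}
    (hs : ∀ s τ, HasDerivAt (fun s => u s τ) (u₁ s τ) s)
    (hτ : ∀ s τ, HasDerivAt (u s) (u₁ s τ) τ)
    (hτ₁ : ∀ s τ, HasDerivAt (u₁ s) (u₂ s τ) τ)
    (hc : ∀ τ, Continuous fun s => u₁ s τ)
    (hb : ∀ R : ℝ, ∃ K, ∀ s ∈ Set.Icc (-R) R, ∀ τ ∈ Set.Icc (-R) R, ‖u₂ s τ‖ ≤ K) (t : ℝ) :
    u t 0 = u 0 t := by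
  have hf : ∀ s₀, HasDerivAt (fun s => u s (t - s)) 0 s₀ := by
    intro s₀
    set τ₀ := t - s₀ with hτ₀
    obtain ⟨K, hK⟩ := hb (|s₀| + |τ₀| + 1)
    have hK0 : 0 ≤ K := (norm_nonneg _).trans (hK 0 ⟨by linarith [abs_nonneg s₀, abs_nonneg τ₀],
      by positivity⟩ 0 ⟨by linarith [abs_nonneg s₀, abs_nonneg τ₀], by positivity⟩)
    have hbd : ∀ s, |s - s₀| ≤ 1 →
        ‖u s (t - s) - u s τ₀ + (s - s₀ : ℝ) • u₁ s τ₀‖ ≤ K * |s - s₀| ^ 2 := by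
      intro s hss
      have hsR : s ∈ Set.Icc (-(|s₀| + |τ₀| + 1)) (|s₀| + |τ₀| + 1) := by
        have := abs_le.1 hss
        constructor <;> linarith [neg_abs_le s₀, le_abs_self s₀, abs_nonneg τ₀]
      have hτR : ∀ τ, |τ - τ₀| ≤ |s - s₀| → τ ∈ Set.Icc (-(|s₀| + |τ₀| + 1)) (|s₀| + |τ₀| + 1) := by
        intro τ h
        have := abs_le.1 (h.trans hss)
        constructor <;> linarith [neg_abs_le τ₀, le_abs_self τ₀, abs_nonneg s₀]
      set B := Metric.closedBall τ₀ |s - s₀| with hB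
      have hBc : Convex ℝ B := convex_closedBall _ _
      have hmem : ∀ {τ}, τ ∈ B → |τ - τ₀| ≤ |s - s₀| := fun h => by
        simpa [hB, Real.dist_eq] using h
      have h0 : τ₀ ∈ B := Metric.mem_closedBall_self (abs_nonneg _)
      have h1 : t - s ∈ B := by
        rw [hB, Metric.mem_closedBall, Real.dist_eq, hτ₀,
          show t - s - (t - s₀) = -(s - s₀) by ring, abs_neg]
      have hu₁ : ∀ τ ∈ B, ‖u₁ s τ - u₁ s τ₀‖ ≤ K * |s - s₀| := by
        intro τ hτB
        refine (hBc.norm_image_sub_le_of_norm_hasDerivWithin_le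
          (fun x _ => (hτ₁ s x).hasDerivWithinAt) (fun x hx => hK s hsR x (hτR x (hmem hx)))
          h0 hτB).trans ?_
        gcongr
        exact hmem hτB
      have hG := hBc.norm_image_sub_le_of_norm_hasDerivWithin_le
        (f := fun τ => u s τ - (τ : ℝ) • u₁ s τ₀) (f' := fun τ => u₁ s τ - (1 : ℝ) • u₁ s τ₀)
        (fun x _ => ((hτ s x).sub ((hasDerivAt_id x).smul_const _)).hasDerivWithinAt)
        (fun x hx => by simpa using hu₁ x hx) h0 h1
      calc _ = ‖u s (t - s) - (t - s) • u₁ s τ₀ - (u s τ₀ - τ₀ • u₁ s τ₀)‖ := by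
            congr 1
            rw [hτ₀, sub_smul, sub_smul, sub_smul]
            abel
        _ ≤ _ := hG
        _ = K * |s - s₀| ^ 2 := by
            rw [hτ₀, Real.norm_eq_abs, show t - s - (t - s₀) = -(s - s₀) by ring, abs_neg]
            ring
    have o1 : (fun s => u s (t - s) - u s τ₀ + (s - s₀ : ℝ) • u₁ s τ₀) =o[𝓝 s₀] fun s => s - s₀ := by
      have hO : (fun s => u s (t - s) - u s τ₀ + (s - s₀ : ℝ) • u₁ s τ₀) =O[𝓝 s₀]
          fun s => (s - s₀) ^ 2 := by
        refine Asymptotics.IsBigO.of_bound K ?_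
        filter_upwards [Metric.closedBall_mem_nhds s₀ one_pos] with s hs
        rw [norm_pow, Real.norm_eq_abs]
        exact hbd s (by simpa [Real.dist_eq] using hs)
      refine hO.trans_isLittleO ?_
      have h := Asymptotics.isLittleO_pow_id (𝕜 := ℝ) (n := 2) one_lt_two
      have ht : Tendsto (fun s => s - s₀) (𝓝 s₀) (𝓝 0) := by
        simpa using (by fun_prop : Continuous fun s : ℝ => s - s₀).tendsto s₀
      exact h.comp_tendsto ht
    have o2 : (fun s => (s - s₀ : ℝ) • (u₁ s τ₀ - u₁ s₀ τ₀)) =o[𝓝 s₀] fun s => s - s₀ := by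
      have h1 : (fun s => u₁ s τ₀ - u₁ s₀ τ₀) =o[𝓝 s₀] fun _ => (1 : ℝ) := by
        rw [Asymptotics.isLittleO_one_iff]
        exact tendsto_sub_nhds_zero_iff.2 ((hc τ₀).tendsto s₀)
      simpa using (Asymptotics.isBigO_refl (fun s : ℝ => s - s₀) (𝓝 s₀)).smul_isLittleO h1
    have o3 := hasDerivAt_iff_isLittleO.1 (hs s₀ τ₀)
    rw [hasDerivAt_iff_isLittleO]
    refine ((o1.sub o2).add o3).congr_left fun s => ?_
    simp only [smul_sub, smul_zero, sub_zero]
    rw [← hτ₀]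
    abel
  have hconst := is_const_of_deriv_eq_zero (f := fun s => u s (t - s))
    (fun s => (hf s).differentiableAt) (fun s => (hf s).deriv) t 0
  simpa using hconst

section Propagation

variable {V : Type*} [NormedAddCommGroup V] [InnerProductSpace ℝ V] [FiniteDimensional ℝ V]
  [MeasurableSpace V] [BorelSpace V]

theorem hasDerivAt_exp_phase (a τ : ℝ) :
    HasDerivAt (fun τ : ℝ => Complex.exp ((τ * a : ℝ) * Complex.I))
      (Complex.I * (a * Complex.exp ((τ * a : ℝ) * Complex.I))) τ := by
  have h1 : HasDerivAt (fun τ : ℝ => ((τ * a : ℝ) : ℂ) * Complex.I) ((a : ℂ) * Complex.I) τ := by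
    have h := ((hasDerivAt_id τ).mul_const a).ofReal_comp.mul_const Complex.I
    simpa using h
  convert h1.cexp using 1
  ring

theorem hasDerivAt_fourier_phaseMul {θ : V → ℝ} (hθ : θ.HasTemperateGrowth) (g : 𝓢(V, ℂ)) (x : V)
    (τ : ℝ) : HasDerivAt (fun τ => (𝓕 (phaseMul θ τ g)) x)
      (Complex.I * (𝓕 (phaseMul θ τ (symbolMul θ g))) x) τ := by
  have e : ∀ φ : 𝓢(V, ℂ), (𝓕 φ) x =
      ∫ v : V, Complex.exp (↑(-2 * Real.pi * inner ℝ v x) * Complex.I) • φ v := fun φ => by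
    rw [SchwartzMap.fourier_coe, Real.fourier_eq']
  simp_rw [e]
  rw [← integral_const_mul]
  have hm : ∀ φ : 𝓢(V, ℂ), Continuous fun v : V =>
      Complex.exp (↑(-2 * Real.pi * inner ℝ v x) * Complex.I) • φ v := by
    intro φ
    fun_prop
  have hn : ∀ (φ : 𝓢(V, ℂ)) v, ‖Complex.exp (↑(-2 * Real.pi * inner ℝ v x) * Complex.I) • φ v‖ =
      ‖φ v‖ := by
    intro φ v
    rw [norm_smul, Complex.norm_exp_ofReal_mul_I, one_mul]
  refine (hasDerivAt_integral_of_dominated_loc_of_deriv_le (s := Set.univ)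
    (bound := fun v => ‖symbolMul θ g v‖)
    (F' := fun τ v => Complex.I * (Complex.exp (↑(-2 * Real.pi * inner ℝ v x) * Complex.I) •
      phaseMul θ τ (symbolMul θ g) v)) univ_mem
    (Eventually.of_forall fun τ => (hm _).aestronglyMeasurable) ?_
    (continuous_const.mul (hm _)).aestronglyMeasurable
    (Eventually.of_forall fun v τ _ => ?_) (symbolMul θ g).integrable.norm
    (Eventually.of_forall fun v τ _ => ?_)).2
  · exact ((phaseMul θ τ g).integrable.norm).mono' (hm _).aestronglyMeasurable
      (Eventually.of_forall fun v => (hn _ v).le)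
  · rw [norm_mul, Complex.norm_I, one_mul, hn, phaseMul_apply hθ, norm_mul,
      Complex.norm_exp_ofReal_mul_I, one_mul]
  · simp only [phaseMul_apply hθ, symbolMul_apply hθ]
    have h := ((hasDerivAt_exp_phase (θ v) τ).mul_const (g v)).const_mul
      (Complex.exp (↑(-2 * Real.pi * inner ℝ v x) * Complex.I))
    refine h.congr_deriv ?_
    simp only [smul_eq_mul]
    ring

theorem fourier_phaseMul_bounded {θ : V → ℝ} (hθ : θ.HasTemperateGrowth) (R : ℝ) (g : 𝓢(V, ℂ)) :
    SchwartzBounded fun τ : Set.Icc (-R) R => 𝓕 (phaseMul θ τ g) :=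
  (phaseMul_bounded hθ R g).map (fourierCLM ℂ 𝓢(V, ℂ))

theorem hasDerivAt_integral_mul_fourier_phaseMul {θ : V → ℝ} (hθ : θ.HasTemperateGrowth)
    {c : V → ℂ} (hc : TemperedFun c) (g : 𝓢(V, ℂ)) (τ : ℝ) :
    HasDerivAt (fun τ => ∫ x, c x * (𝓕 (phaseMul θ τ g)) x)
      (Complex.I * ∫ x, c x * (𝓕 (phaseMul θ τ (symbolMul θ g))) x) τ := by
  obtain ⟨hint, -⟩ := hc.exists_clm
  obtain ⟨N, hN⟩ := hc
  set R := |τ| + 1 with hR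
  obtain ⟨C, hC0, hC⟩ := (fourier_phaseMul_bounded hθ R (symbolMul θ g)).decay N
  rw [← integral_const_mul]
  refine (hasDerivAt_integral_of_dominated_loc_of_deriv_le (s := Set.Icc (-R) R)
    (bound := fun x => C * ‖(((1 + ‖x‖) ^ N)⁻¹ : ℝ) • c x‖)
    (F' := fun τ x => Complex.I * (c x * (𝓕 (phaseMul θ τ (symbolMul θ g))) x))
    (Icc_mem_nhds (by linarith [neg_abs_le τ]) (by linarith [le_abs_self τ]))
    (Eventually.of_forall fun τ => (hint _).aestronglyMeasurable) (hint _)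
    ((hint _).const_mul _).aestronglyMeasurable (Eventually.of_forall fun x τ hτ => ?_)
    (hN.norm.const_mul C) (Eventually.of_forall fun x τ _ => ?_)).2
  · rw [norm_mul, Complex.norm_I, one_mul, norm_mul, norm_smul, norm_inv,
      Real.norm_of_nonneg (by positivity)]
    calc _ ≤ ‖c x‖ * (C * ((1 + ‖x‖) ^ N)⁻¹) := by
          gcongr
          exact hC ⟨τ, hτ⟩ x
      _ = _ := by ring
  · refine ((hasDerivAt_fourier_phaseMul hθ g x τ).const_mul (c x)).congr_deriv ?_
    ring

/-- Uniqueness for the evolution equation whose generator has the real symbol `θ`: a solution in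
the weak sense is obtained from its initial value by the Fourier multiplier `exp(i t θ)`. -/
theorem integral_mul_fourier_eq_of_hasDerivAt {θ : V → ℝ} (hθ : θ.HasTemperateGrowth)
    {γ : ℝ → V → ℂ} (hγ : ∀ t, TemperedFun (γ t)) {D : 𝓢(V, ℂ) → 𝓢(V, ℂ)}
    (hD : ∀ g : 𝓢(V, ℂ), D (𝓕 g) = 𝓕 (symbolMul θ g))
    (heq : ∀ (φ : 𝓢(V, ℂ)) (t : ℝ),
      HasDerivAt (fun s => ∫ x, γ s x * φ x) (Complex.I * ∫ x, γ t x * D φ x) t)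
    (g : 𝓢(V, ℂ)) (t : ℝ) :
    ∫ x, γ t x * (𝓕 g) x = ∫ x, γ 0 x * (𝓕 (phaseMul θ t g)) x := by
  choose T hT using fun t => (hγ t).exists_clm.2
  have h0 : ∀ g : 𝓢(V, ℂ), phaseMul θ 0 g = g := by
    intro g
    ext v
    simp [phaseMul_apply hθ]
  have key := eq_of_partialDeriv_eq
    (u := fun s τ => ∫ x, γ s x * (𝓕 (phaseMul θ τ g)) x)
    (u₁ := fun s τ => Complex.I * ∫ x, γ s x * (𝓕 (phaseMul θ τ (symbolMul θ g))) x)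
    (u₂ := fun s τ => Complex.I * (Complex.I *
      ∫ x, γ s x * (𝓕 (phaseMul θ τ (symbolMul θ (symbolMul θ g)))) x))
    (fun s τ => by
      have h := heq (𝓕 (phaseMul θ τ g)) s
      rwa [hD, symbolMul_phaseMul hθ] at h)
    (fun s τ => hasDerivAt_integral_mul_fourier_phaseMul hθ (hγ s) g τ)
    (fun s τ => (hasDerivAt_integral_mul_fourier_phaseMul hθ (hγ s) (symbolMul θ g) τ).const_mul _)
    (fun τ => continuous_const.mul (continuous_iff_continuousAt.2 fun s =>
      (heq (𝓕 (phaseMul θ τ (symbolMul θ g))) s).continuousAt))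
    (fun R => by
      obtain ⟨K, hK⟩ := (fourier_phaseMul_bounded hθ R
        (symbolMul θ (symbolMul θ g))).uniform_bound (fun s : Set.Icc (-R) R => T s) (fun ψ => by
          have hcont : Continuous fun s => ∫ x, γ s x * ψ x :=
            continuous_iff_continuousAt.2 fun s => (heq ψ s).continuousAt
          obtain ⟨C, hC⟩ := isCompact_Icc.exists_bound_of_continuousOn (hcont.continuousOn
            (s := Set.Icc (-R) R))
          exact ⟨C, fun s => by rw [hT]; exact hC s s.2⟩)
      refine ⟨K, fun s hs τ hτ => ?_⟩
      rw [norm_mul, norm_mul, Complex.norm_I, one_mul, one_mul, ← hT]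
      exact hK ⟨s, hs⟩ ⟨τ, hτ⟩) t
  simpa [h0] using key

/-- A weak solution of the equation with symbol `θ`, expressed through the Fourier transform `h` of its
initial value. -/
theorem integral_mul_eq_integral_phase {θ : V → ℝ} (hθ : θ.HasTemperateGrowth)
    {γ : ℝ → V → ℂ} (hγ : ∀ t, TemperedFun (γ t)) {D : 𝓢(V, ℂ) → 𝓢(V, ℂ)}
    (hD : ∀ g : 𝓢(V, ℂ), D (𝓕 g) = 𝓕 (symbolMul θ g))
    (heq : ∀ (φ : 𝓢(V, ℂ)) (t : ℝ),
      HasDerivAt (fun s => ∫ x, γ s x * φ x) (Complex.I * ∫ x, γ t x * D φ x) t)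
    {γ₀ : 𝓢'(V, ℂ)} (h₀ : Represents γ₀ (γ 0)) {h : V → ℂ} (hh : Represents (𝓕 γ₀) h)
    (ψ : 𝓢(V, ℂ)) (t : ℝ) :
    ∫ x, γ t x * ψ x = ∫ ξ, Complex.exp ((t * θ ξ : ℝ) * Complex.I) * (h ξ * (𝓕⁻ ψ) ξ) := by
  have h1 := integral_mul_fourier_eq_of_hasDerivAt hθ hγ hD heq (𝓕⁻ ψ) t
  rw [FourierTransform.fourier_fourierInv_eq, ← h₀.2, ← TemperedDistribution.fourier_apply,
    hh.2] at h1
  rw [h1]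
  refine integral_congr_ae (Eventually.of_forall fun ξ => ?_)
  simp only [phaseMul_apply hθ]
  ring

end Propagation

/-! ### Integration in time -/

section TimeIntegral

variable {V : Type*} [NormedAddCommGroup V] [InnerProductSpace ℝ V] [FiniteDimensional ℝ V]
  [MeasurableSpace V] [BorelSpace V]

theorem fourierInv_slice_apply (Ψ : 𝓢(WithLp 2 (ℝ × V), ℂ)) (t : ℝ) (ξ : V) :
    (𝓕⁻ (slice t Ψ)) ξ =
      ∫ v : V, Complex.exp (↑(2 * Real.pi * inner ℝ v ξ) * Complex.I) * Ψ (WithLp.toLp 2 (t, v)) := by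
  rw [SchwartzMap.fourierInv_coe, Real.fourierInv_eq']
  rfl

/-- The inverse Fourier transform in space-time is the one in time of the one in space. -/
theorem fourierInv_toLp (Ψ : 𝓢(WithLp 2 (ℝ × V), ℂ)) (a : ℝ) (ξ : V) :
    (𝓕⁻ Ψ) (WithLp.toLp 2 (a, ξ)) =
      ∫ t : ℝ, Complex.exp (↑(2 * Real.pi * (t * a)) * Complex.I) * (𝓕⁻ (slice t Ψ)) ξ := by
  have hmp := WithLp.volume_preserving_toLp ℝ V
  have hemb : MeasurableEmbedding (WithLp.toLp 2 : ℝ × V → WithLp 2 (ℝ × V)) :=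
    (MeasurableEquiv.toLp 2 (ℝ × V)).measurableEmbedding
  have hint : Integrable fun z : WithLp 2 (ℝ × V) =>
      Complex.exp (↑(2 * Real.pi * inner ℝ z (WithLp.toLp 2 (a, ξ))) * Complex.I) • Ψ z :=
    Ψ.integrable.norm.mono' (by fun_prop : Continuous _).aestronglyMeasurable
      (Eventually.of_forall fun z => by rw [norm_smul, Complex.norm_exp_ofReal_mul_I, one_mul])
  have hint' : Integrable (fun z : ℝ × V =>
      Complex.exp (↑(2 * Real.pi * inner ℝ (WithLp.toLp 2 z) (WithLp.toLp 2 (a, ξ))) * Complex.I) •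
        Ψ (WithLp.toLp 2 z)) (volume.prod volume) := (hmp.integrable_comp_emb hemb).2 hint
  rw [SchwartzMap.fourierInv_coe, Real.fourierInv_eq', ← hmp.integral_comp hemb,
    Measure.volume_eq_prod, integral_prod _ hint']
  refine integral_congr_ae (Eventually.of_forall fun t => ?_)
  simp only
  rw [fourierInv_slice_apply, ← integral_const_mul]
  refine integral_congr_ae (Eventually.of_forall fun v => ?_)
  simp only [smul_eq_mul]
  rw [← mul_assoc, ← Complex.exp_add, WithLp.prod_inner_apply]
  congr 2
  simp
  ring

theorem stronglyMeasurable_fourierInv_slice (Ψ : 𝓢(WithLp 2 (ℝ × V), ℂ)) :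
    StronglyMeasurable fun p : ℝ × V => (𝓕⁻ (slice p.1 Ψ)) p.2 := by
  simp_rw [fourierInv_slice_apply]
  refine StronglyMeasurable.integral_prod_right (f := fun (p : ℝ × V) v =>
    Complex.exp (↑(2 * Real.pi * inner ℝ v p.2) * Complex.I) * Ψ (WithLp.toLp 2 (p.1, v))) ?_
  refine Continuous.stronglyMeasurable ?_
  have : Continuous fun q : (ℝ × V) × V => (WithLp.toLp 2 (q.1.1, q.2) : WithLp 2 (ℝ × V)) :=
    (WithLp.prod_continuous_toLp 2 ℝ V).comp (by fun_prop)
  have h2 := Ψ.continuous.comp this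
  exact Continuous.mul (by fun_prop) h2

/-- The time integral of the free evolution with symbol `θ` tested against `Ψ` is the integral of
the space-time Fourier transform of `Ψ` over the characteristic surface `2π τ = θ(ξ)`. -/
theorem integral_phase_slice {θ : V → ℝ} (hθ : θ.HasTemperateGrowth) {h : V → ℂ}
    (hh : TemperedFun h) (Ψ : 𝓢(WithLp 2 (ℝ × V), ℂ)) :
    Integrable (fun t : ℝ => ∫ ξ, Complex.exp ((t * θ ξ : ℝ) * Complex.I) *
      (h ξ * (𝓕⁻ (slice t Ψ)) ξ)) ∧
    ∫ t : ℝ, ∫ ξ, Complex.exp ((t * θ ξ : ℝ) * Complex.I) * (h ξ * (𝓕⁻ (slice t Ψ)) ξ) =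
      ∫ ξ, h ξ * (𝓕⁻ Ψ) (WithLp.toLp 2 (θ ξ / (2 * Real.pi), ξ)) := by
  have hm := hh.aestronglyMeasurable
  obtain ⟨N, hN⟩ := hh
  obtain ⟨C, hC0, hC⟩ := ((slice_bounded Ψ).map (fourierInvCLM ℂ 𝓢(V, ℂ))).decay N
  have hbd : ∀ t ξ, ‖(𝓕⁻ (slice t Ψ)) ξ‖ ≤ (1 + t ^ 2)⁻¹ * (C * ((1 + ‖ξ‖) ^ N)⁻¹) := by
    intro t ξ
    have h1 := hC t ξ
    rw [map_smul, smul_apply, norm_smul, Complex.norm_real, Real.norm_of_nonneg (by positivity)] at h1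
    rw [inv_mul_eq_div, le_div_iff₀' (by positivity)]
    exact h1
  have hint : Integrable (Function.uncurry fun (t : ℝ) (ξ : V) =>
      Complex.exp ((t * θ ξ : ℝ) * Complex.I) * (h ξ * (𝓕⁻ (slice t Ψ)) ξ))
      (volume.prod volume) := by
    refine ((integrable_inv_one_add_sq.mul_prod hN.norm).const_mul C).mono' ?_
      (Eventually.of_forall fun p => ?_)
    · refine AEStronglyMeasurable.mul ?_ (hm.comp_snd.mul
        (stronglyMeasurable_fourierInv_slice Ψ).aestronglyMeasurable)
      have : Continuous θ := hθ.1.continuous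
      exact (by fun_prop : Continuous _).aestronglyMeasurable
    · simp only [Function.uncurry]
      rw [norm_mul, Complex.norm_exp_ofReal_mul_I, one_mul, norm_mul, norm_smul, norm_inv,
        Real.norm_of_nonneg (by positivity)]
      calc _ ≤ ‖h p.2‖ * ((1 + p.1 ^ 2)⁻¹ * (C * ((1 + ‖p.2‖) ^ N)⁻¹)) := by
            gcongr
            exact hbd p.1 p.2
        _ = _ := by ring
  refine ⟨hint.integral_prod_left, ?_⟩
  rw [integral_integral_swap hint]
  refine integral_congr_ae (Eventually.of_forall fun ξ => ?_)
  simp only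
  rw [fourierInv_toLp, ← integral_const_mul]
  refine integral_congr_ae (Eventually.of_forall fun t => ?_)
  simp only
  rw [show 2 * Real.pi * (t * (θ ξ / (2 * Real.pi))) = t * θ ξ by field_simp]
  ring

end TimeIntegral

/-! ### Momenta of `k + 1` particles and the symbol of the equation -/

namespace Conf

variable {k : ℕ}

/-- The configuration `(z, x_{k+1}, x'_{k+1})` of `k + 1` particles. -/
def glue (z : Conf k) (x x' : R3) : Conf (k + 1) :=
  WithLp.toLp 2 (Sum.elim (Fin.snoc (α := fun _ => R3) (fun i => z (Sum.inl i)) x)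
    (Fin.snoc (α := fun _ => R3) (fun i => z (Sum.inr i)) x'))

@[simp]
theorem glue_inl_castSucc (z : Conf k) (x x' : R3) (i : Fin k) :
    glue z x x' (Sum.inl i.castSucc) = z (Sum.inl i) := by simp [glue]

@[simp]
theorem glue_inr_castSucc (z : Conf k) (x x' : R3) (i : Fin k) :
    glue z x x' (Sum.inr i.castSucc) = z (Sum.inr i) := by simp [glue]

@[simp]
theorem glue_inl_last (z : Conf k) (x x' : R3) : glue z x x' (Sum.inl (Fin.last k)) = x := by
  simp [glue]

@[simp]
theorem glue_inr_last (z : Conf k) (x x' : R3) : glue z x x' (Sum.inr (Fin.last k)) = x' := by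
  simp [glue]

@[simp]
theorem forget_inl (z : Conf (k + 1)) (i : Fin k) : z.forget (Sum.inl i) = z (Sum.inl i.castSucc) :=
  rfl

@[simp]
theorem forget_inr (z : Conf (k + 1)) (i : Fin k) : z.forget (Sum.inr i) = z (Sum.inr i.castSucc) :=
  rfl

@[simp]
theorem forget_glue (z : Conf k) (x x' : R3) : (glue z x x').forget = z := by
  ext s : 1
  rcases s with i | i <;> simp

theorem glue_forget (z : Conf (k + 1)) :
    glue z.forget (z (Sum.inl (Fin.last k))) (z (Sum.inr (Fin.last k))) = z := by
  ext s : 1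
  rcases s with i | i <;> refine Fin.lastCases ?_ (fun i => ?_) i <;> simp

theorem sum_eq_forget {M : Type*} [AddCommMonoid M] (f : Fin (k + 1) ⊕ Fin (k + 1) → M) :
    ∑ s, f s = (∑ s : Fin k ⊕ Fin k, f (Sum.map Fin.castSucc Fin.castSucc s)) +
      (f (Sum.inl (Fin.last k)) + f (Sum.inr (Fin.last k))) := by
  simp only [Fintype.sum_sum_type, Fin.sum_univ_castSucc, Sum.map_inl, Sum.map_inr]
  abel

theorem prod_eq_forget {M : Type*} [CommMonoid M] (f : Fin (k + 1) ⊕ Fin (k + 1) → M) :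
    ∏ s, f s = (∏ s : Fin k ⊕ Fin k, f (Sum.map Fin.castSucc Fin.castSucc s)) *
      (f (Sum.inl (Fin.last k)) * f (Sum.inr (Fin.last k))) := by
  simp only [Fintype.prod_sum_type, Fin.prod_univ_castSucc, Sum.map_inl, Sum.map_inr]
  exact mul_mul_mul_comm _ _ _ _

theorem forget_apply (z : Conf (k + 1)) (s : Fin k ⊕ Fin k) :
    z.forget s = z (Sum.map Fin.castSucc Fin.castSucc s) := rfl

theorem forget_add (z w : Conf (k + 1)) : (z + w).forget = z.forget + w.forget := rfl

theorem forget_smul (c : ℝ) (z : Conf (k + 1)) : (c • z).forget = c • z.forget := rfl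

theorem inner_eq_forget (z ζ : Conf (k + 1)) :
    inner ℝ z ζ = inner ℝ z.forget ζ.forget +
      (inner ℝ (z (Sum.inl (Fin.last k))) (ζ (Sum.inl (Fin.last k))) +
       inner ℝ (z (Sum.inr (Fin.last k))) (ζ (Sum.inr (Fin.last k)))) := by
  rw [PiLp.inner_apply, PiLp.inner_apply, sum_eq_forget]
  rfl

/-- `Conf (k + 1)` is isometric to `Conf k × ℝ³ × ℝ³`. -/
def splitEquiv (k : ℕ) : Conf (k + 1) ≃ₗᵢ[ℝ] WithLp 2 (Conf k × WithLp 2 (R3 × R3)) where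
  toFun z := WithLp.toLp 2
    (z.forget, WithLp.toLp 2 (z (Sum.inl (Fin.last k)), z (Sum.inr (Fin.last k))))
  invFun w := glue w.fst w.snd.fst w.snd.snd
  map_add' z w := rfl
  map_smul' c z := rfl
  left_inv z := glue_forget z
  right_inv w := by
    simp
    rfl
  norm_map' z := by
    rw [← sq_eq_sq₀ (norm_nonneg _) (norm_nonneg _), ← real_inner_self_eq_norm_sq,
      ← real_inner_self_eq_norm_sq, inner_eq_forget]
    rfl

theorem measurePreserving_glue :
    MeasurePreserving (fun q : Conf k × R3 × R3 => glue q.1 q.2.1 q.2.2) volume volume :=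
  (splitEquiv k).symm.measurePreserving.comp
    ((WithLp.volume_preserving_toLp (Conf k) (WithLp 2 (R3 × R3))).comp
      ((MeasurePreserving.id (volume : Measure (Conf k))).prod (WithLp.volume_preserving_toLp R3 R3)))

theorem measurableEmbedding_glue :
    MeasurableEmbedding fun q : Conf k × R3 × R3 => glue q.1 q.2.1 q.2.2 :=
  (splitEquiv k).symm.toMeasurableEquiv.measurableEmbedding.comp
    ((MeasurableEquiv.toLp 2 (Conf k × WithLp 2 (R3 × R3))).measurableEmbedding.comp
      (MeasurableEmbedding.id.prodMap (MeasurableEquiv.toLp 2 (R3 × R3)).measurableEmbedding))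

/-- The momentum of `k` particles obtained by adding the momenta of `x_{k+1}` and `x'_{k+1}` to the
one labelled by `s`; this is the effect on the Fourier side of setting
`x_{k+1} = x'_{k+1} = x_s`. -/
def collapse (s : Fin k ⊕ Fin k) (ζ : Conf (k + 1)) : Conf k :=
  ζ.forget + PiLp.single 2 s (ζ (Sum.inl (Fin.last k)) + ζ (Sum.inr (Fin.last k)))

@[simp]
theorem collapse_glue (s : Fin k ⊕ Fin k) (z : Conf k) (x x' : R3) :
    collapse s (glue z x x') = z + PiLp.single 2 s (x + x') := by
  simp [collapse]

/-- The symbol `∑ᵢ |ξᵢ|² - ∑ᵢ |ξ'ᵢ|²`. -/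
def kinetic (ξ : Conf k) : ℝ := ∑ s, Sum.elim (fun _ => 1) (fun _ => -1) s * ‖ξ s‖ ^ 2

theorem kinetic_glue (z : Conf k) (x x' : R3) :
    kinetic (glue z x x') = kinetic z + (‖x‖ ^ 2 - ‖x'‖ ^ 2) := by
  unfold kinetic
  rw [sum_eq_forget]
  congr 1
  · refine Finset.sum_congr rfl fun s _ => ?_
    rw [← forget_apply, forget_glue]
    rcases s with i | i <;> rfl
  · simp [sub_eq_add_neg]

theorem kinetic_sub_single (ξ : Conf k) (s : Fin k ⊕ Fin k) (v : R3) :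
    kinetic (ξ - PiLp.single 2 s v) = kinetic ξ +
      Sum.elim (fun _ => 1) (fun _ => -1) s * (‖ξ s - v‖ ^ 2 - ‖ξ s‖ ^ 2) := by
  classical
  unfold kinetic
  rw [← sub_eq_iff_eq_add', ← Finset.sum_sub_distrib, Finset.sum_eq_single s]
  · simp [mul_sub]
  · intro s' _ hs'
    simp [hs']
  · simp

theorem kinetic_hasTemperateGrowth : Function.HasTemperateGrowth (kinetic (k := k)) := by
  refine Function.HasTemperateGrowth.sum fun s _ => (Function.HasTemperateGrowth.const _).mul ?_
  exact (Function.hasTemperateGrowth_norm_sq R3).comp (PiLp.proj 2 (fun _ => R3) s).hasTemperateGrowth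

/-- The symbol of the operator `deltaPM`. -/
def symbol (ξ : Conf k) : ℝ := -(2 * Real.pi) ^ 2 * kinetic ξ

theorem symbol_hasTemperateGrowth : Function.HasTemperateGrowth (symbol (k := k)) :=
  (Function.HasTemperateGrowth.const _).mul kinetic_hasTemperateGrowth

end Conf

theorem lineDerivOp_lineDerivOp_fourier {V : Type*} [NormedAddCommGroup V] [InnerProductSpace ℝ V]
    [FiniteDimensional ℝ V] [MeasurableSpace V] [BorelSpace V] (g : 𝓢(V, ℂ)) (m : V) :
    ∂_{m} (∂_{m} (𝓕 g)) = 𝓕 (symbolMul (fun ξ => -(2 * Real.pi) ^ 2 * inner ℝ ξ m ^ 2) g) := by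
  have h1 : Function.HasTemperateGrowth fun ξ : V => inner ℝ ξ m :=
    Function.hasTemperateGrowth_inner_left m
  have h2 : Function.HasTemperateGrowth fun ξ : V => -(2 * Real.pi) ^ 2 * inner ℝ ξ m ^ 2 :=
    (Function.HasTemperateGrowth.const _).mul (h1.pow 2)
  rw [SchwartzMap.lineDerivOp_fourier_eq, SchwartzMap.lineDerivOp_fourier_eq]
  congr 1
  ext ξ
  rw [symbolMul_apply h2]
  simp only [smul_apply, smulLeftCLM_apply_apply h1]
  push_cast
  simp only [smul_eq_mul, Complex.real_smul]
  linear_combination (4 * (Real.pi : ℂ) ^ 2 * (inner ℝ ξ m : ℝ) ^ 2 * g ξ) * Complex.I_sq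

theorem deltaPM_fourier {k : ℕ} (g : 𝓢(Conf k, ℂ)) :
    deltaPM (𝓕 g) = 𝓕 (symbolMul Conf.symbol g) := by
  have hsum : ∀ (f : Fin k → Fin 3 → 𝓢(Conf k, ℂ)),
      ∑ i, ∑ a, 𝓕 (f i a) = 𝓕 (∑ i, ∑ a, f i a) := by
    intro f
    have h (ι : Type) [Fintype ι] (f : ι → 𝓢(Conf k, ℂ)) : ∑ i, 𝓕 (f i) = 𝓕 (∑ i, f i) :=
      (map_sum (fourierCLM ℂ 𝓢(Conf k, ℂ)) f Finset.univ).symm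
    simp only [h]
  have hsub : ∀ f f' : 𝓢(Conf k, ℂ), 𝓕 f - 𝓕 f' = 𝓕 (f - f') := fun f f' =>
    (map_sub (fourierCLM ℂ 𝓢(Conf k, ℂ)) f f').symm
  unfold deltaPM
  simp only [lineDerivOp_lineDerivOp_fourier]
  rw [hsum, hsum, hsub]
  congr 1
  ext ξ
  have h2 : ∀ m : Conf k, Function.HasTemperateGrowth
      fun ξ : Conf k => -(2 * Real.pi) ^ 2 * inner ℝ ξ m ^ 2 := fun m =>
    (Function.HasTemperateGrowth.const _).mul ((Function.hasTemperateGrowth_inner_left m).pow 2)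
  have hunit : ∀ s a, inner ℝ ξ (Conf.unit s a) = ξ s a := by
    intro s a
    simp [Conf.unit, PiLp.inner_apply, PiLp.single_apply, apply_ite]
  rw [symbolMul_apply Conf.symbol_hasTemperateGrowth]
  simp only [sub_apply, sum_apply, symbolMul_apply (h2 _), hunit]
  simp only [Conf.symbol, Conf.kinetic, Fintype.sum_sum_type, EuclideanSpace.real_norm_sq_eq,
    Sum.elim_inl, Sum.elim_inr]
  push_cast
  simp only [Finset.mul_sum, Finset.sum_mul, mul_add, add_mul, sub_eq_add_neg,
    ← Finset.sum_neg_distrib]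
  congr 1
  all_goals
    refine Finset.sum_congr rfl fun i _ => Finset.sum_congr rfl fun a _ => ?_
    ring

/-! ### The mollified collapse on the Fourier side -/

/-- Version of `SchwartzMap.exists_mul_comp` in finite dimension, where joint injectivity of the two
linear maps suffices. -/
theorem SchwartzMap.exists_mul_comp_of_injective {E E₁ E₂ : Type*} [NormedAddCommGroup E]
    [NormedSpace ℝ E] [FiniteDimensional ℝ E]
    [NormedAddCommGroup E₁] [NormedSpace ℝ E₁] [NormedAddCommGroup E₂] [NormedSpace ℝ E₂]
    (L₁ : E →ₗ[ℝ] E₁) (L₂ : E →ₗ[ℝ] E₂) (hL : ∀ z, L₁ z = 0 → L₂ z = 0 → z = 0)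
    (f : 𝓢(E₁, ℂ)) (g : 𝓢(E₂, ℂ)) : ∃ Φ : 𝓢(E, ℂ), ∀ z, Φ z = f (L₁ z) * g (L₂ z) := by
  obtain ⟨K, -, hK⟩ := (L₁.prod L₂).exists_antilipschitzWith <| LinearMap.ker_eq_bot'.2 fun z hz =>
    hL z (congrArg Prod.fst hz) (congrArg Prod.snd hz)
  refine exists_mul_comp L₁.toContinuousLinearMap L₂.toContinuousLinearMap (C := K) (fun z => ?_) f g
  have h := hK.le_mul_dist z 0
  rw [map_zero, dist_zero_right, dist_zero_right] at h
  refine h.trans (mul_le_mul_of_nonneg_left ?_ K.2)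
  exact max_le (le_add_of_nonneg_right (norm_nonneg _)) (le_add_of_nonneg_left (norm_nonneg _))

theorem integral_exp_mul_approxDelta (χ : 𝓢(R3, ℂ)) {ε : ℝ} (hε : 0 < ε) (y η : R3) :
    ∫ x, Complex.exp (↑(2 * Real.pi * inner ℝ x η) * Complex.I) * approxDelta χ ε (y - x) =
      Complex.exp (↑(2 * Real.pi * inner ℝ y η) * Complex.I) * (𝓕 χ) (ε • η) := by
  rw [← integral_sub_left_eq_self _ volume y, SchwartzMap.fourier_coe, Real.fourier_eq']
  have hs := Measure.integral_comp_smul (volume : Measure R3)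
    (fun v => Complex.exp (↑(-2 * Real.pi * inner ℝ v (ε • η)) * Complex.I) * χ v) ε⁻¹
  have h3 : |((ε⁻¹) ^ Module.finrank ℝ R3)⁻¹| = ε ^ 3 := by
    rw [finrank_euclideanSpace_fin, inv_pow, inv_inv, abs_of_pos (by positivity)]
  rw [h3] at hs
  have hs' : ∫ v, Complex.exp (↑(-2 * Real.pi * inner ℝ v (ε • η)) * Complex.I) • χ v =
      ((ε ^ 3)⁻¹ : ℝ) • ∫ x, Complex.exp (↑(-2 * Real.pi * inner ℝ (ε⁻¹ • x) (ε • η)) * Complex.I) *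
        χ (ε⁻¹ • x) := by
    rw [hs, smul_smul, inv_mul_cancel₀ (by positivity), one_smul]
    simp only [smul_eq_mul]
  rw [hs', ← integral_smul, ← integral_const_mul]
  refine integral_congr_ae (Eventually.of_forall fun u => ?_)
  simp only [approxDelta, sub_sub_cancel]
  rw [inner_smul_left, inner_smul_right, inner_sub_left]
  simp only [Complex.real_smul]
  rw [show Complex.exp (↑(2 * Real.pi * (inner ℝ y η - inner ℝ u η)) * Complex.I) =
    Complex.exp (↑(2 * Real.pi * inner ℝ y η) * Complex.I) *
    Complex.exp (↑(-2 * Real.pi * ((starRingEnd ℝ) ε⁻¹ * (ε * inner ℝ u η))) * Complex.I) by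
      rw [← Complex.exp_add, ← add_mul, ← Complex.ofReal_add]
      congr 4
      simp only [conj_trivial]
      field_simp
      ring]
  ring

/-- The integrand of `mollifiedPairing` is `γ` times a Schwartz function on space-time. -/
theorem exists_mollified {k : ℕ} (s : Fin k ⊕ Fin k) (χ : 𝓢(R3, ℂ)) (Φ : 𝓢(STConf k, ℂ)) {ε : ℝ}
    (hε : 0 < ε) : ∃ Ψ : 𝓢(STConf (k + 1), ℂ), ∀ (t : ℝ) (z : Conf (k + 1)),
      Ψ (WithLp.toLp 2 (t, z)) =
        approxDelta χ ε (z.forget s - z (Sum.inl (Fin.last k))) *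
          approxDelta χ ε (z.forget s - z (Sum.inr (Fin.last k))) *
          Φ (WithLp.toLp 2 (t, z.forget)) := by
  obtain ⟨f, hf⟩ := SchwartzMap.exists_mul_comp_of_injective (LinearMap.fst ℝ R3 R3)
    (LinearMap.snd ℝ R3 R3) (fun z h₁ h₂ => Prod.ext h₁ h₂) χ χ
  let L₁ : STConf (k + 1) →ₗ[ℝ] R3 × R3 :=
    { toFun := fun w => (ε⁻¹ • (w.snd.forget s - w.snd (Sum.inl (Fin.last k))),
        ε⁻¹ • (w.snd.forget s - w.snd (Sum.inr (Fin.last k))))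
      map_add' := fun w w' => by
        ext : 1 <;> simp [Conf.forget_add, smul_sub, smul_add] <;> abel
      map_smul' := fun c w => by
        ext : 1 <;> simp [Conf.forget_smul, smul_sub, smul_comm c] }
  let L₂ : STConf (k + 1) →ₗ[ℝ] STConf k :=
    { toFun := fun w => WithLp.toLp 2 (w.fst, w.snd.forget)
      map_add' := fun w w' => rfl
      map_smul' := fun c w => rfl }
  obtain ⟨Ψ, hΨ⟩ := SchwartzMap.exists_mul_comp_of_injective L₁ L₂ (fun w h₁ h₂ => by
    have hfst : w.fst = 0 := congrArg WithLp.fst h₂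
    have hfor : w.snd.forget = 0 := congrArg WithLp.snd h₂
    have hl : ε⁻¹ • (w.snd.forget s - w.snd (Sum.inl (Fin.last k))) = 0 := congrArg Prod.fst h₁
    have hr : ε⁻¹ • (w.snd.forget s - w.snd (Sum.inr (Fin.last k))) = 0 := congrArg Prod.snd h₁
    simp only [hfor, PiLp.zero_apply, zero_sub, smul_eq_zero, inv_eq_zero, hε.ne', false_or,
      neg_eq_zero] at hl hr
    have hsnd : w.snd = 0 := by
      rw [← Conf.glue_forget w.snd, hfor, hl, hr]
      ext i : 1
      rcases i with i | i <;> refine Fin.lastCases ?_ (fun i => ?_) i <;> simp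
    exact WithLp.ofLp_injective 2 (Prod.ext hfst hsnd)) f Φ
  refine ⟨((ε ^ 3)⁻¹ * (ε ^ 3)⁻¹ : ℝ) • Ψ, fun t z => ?_⟩
  rw [smul_apply, hΨ, hf]
  have h₁ : L₁ (WithLp.toLp 2 (t, z)) = (ε⁻¹ • (z.forget s - z (Sum.inl (Fin.last k))),
    ε⁻¹ • (z.forget s - z (Sum.inr (Fin.last k)))) := rfl
  have h₂ : L₂ (WithLp.toLp 2 (t, z)) = WithLp.toLp 2 (t, z.forget) := rfl
  simp only [approxDelta, Complex.real_smul, h₁, h₂, LinearMap.fst_apply, LinearMap.snd_apply]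
  push_cast
  ring

/-- The inverse Fourier transform in space of the test function of `exists_mollified`: in the last two
variables one integrates `δ_ε` against a plane wave. -/
theorem fourierInv_mollified_slice {k : ℕ} (s : Fin k ⊕ Fin k) (χ : 𝓢(R3, ℂ))
    (Φ : 𝓢(STConf k, ℂ)) {ε : ℝ} (hε : 0 < ε) {Ψ : 𝓢(STConf (k + 1), ℂ)}
    (hΨ : ∀ (t : ℝ) (z : Conf (k + 1)), Ψ (WithLp.toLp 2 (t, z)) =
        approxDelta χ ε (z.forget s - z (Sum.inl (Fin.last k))) *
          approxDelta χ ε (z.forget s - z (Sum.inr (Fin.last k))) *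
          Φ (WithLp.toLp 2 (t, z.forget))) (t : ℝ) (ζ : Conf (k + 1)) :
    (𝓕⁻ (slice t Ψ)) ζ = (𝓕 χ) (ε • ζ (Sum.inl (Fin.last k))) *
      (𝓕 χ) (ε • ζ (Sum.inr (Fin.last k))) * (𝓕⁻ (slice t Φ)) (Conf.collapse s ζ) := by
  have hmp := Conf.measurePreserving_glue (k := k)
  have hemb := Conf.measurableEmbedding_glue (k := k)
  have hint : Integrable fun z : Conf (k + 1) =>
      Complex.exp (↑(2 * Real.pi * inner ℝ z ζ) * Complex.I) * Ψ (WithLp.toLp 2 (t, z)) := by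
    refine (slice t Ψ).integrable.norm.mono' ?_ (Eventually.of_forall fun z => ?_)
    · exact ((by fun_prop : Continuous fun z : Conf (k + 1) =>
        Complex.exp (↑(2 * Real.pi * inner ℝ z ζ) * Complex.I)).mul
          (slice t Ψ).continuous).aestronglyMeasurable
    · rw [norm_mul, Complex.norm_exp_ofReal_mul_I, one_mul, slice_apply]
  have hint' : Integrable (fun q : Conf k × R3 × R3 =>
      Complex.exp (↑(2 * Real.pi * inner ℝ (Conf.glue q.1 q.2.1 q.2.2) ζ) * Complex.I) *
        Ψ (WithLp.toLp 2 (t, Conf.glue q.1 q.2.1 q.2.2))) (volume.prod volume) :=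
    (hmp.integrable_comp_emb hemb).2 hint
  rw [fourierInv_slice_apply, fourierInv_slice_apply, ← hmp.integral_comp hemb, Measure.volume_eq_prod,
    integral_prod _ hint', ← integral_const_mul]
  refine integral_congr_ae (Eventually.of_forall fun z => ?_)
  simp only [Measure.volume_eq_prod]
  set η := ζ (Sum.inl (Fin.last k)) with hη
  set η' := ζ (Sum.inr (Fin.last k)) with hη'
  have hpt : ∀ q : R3 × R3, Complex.exp (↑(2 * Real.pi * inner ℝ (Conf.glue z q.1 q.2) ζ) * Complex.I) *
      Ψ (WithLp.toLp 2 (t, Conf.glue z q.1 q.2)) =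
      (Complex.exp (↑(2 * Real.pi * inner ℝ z ζ.forget) * Complex.I) * Φ (WithLp.toLp 2 (t, z))) *
      ((Complex.exp (↑(2 * Real.pi * inner ℝ q.1 η) * Complex.I) * approxDelta χ ε (z s - q.1)) *
       (Complex.exp (↑(2 * Real.pi * inner ℝ q.2 η') * Complex.I) * approxDelta χ ε (z s - q.2))) := by
    intro q
    rw [hΨ, Conf.inner_eq_forget]
    simp only [Conf.forget_glue, Conf.glue_inl_last, Conf.glue_inr_last]
    simp only [mul_add, add_mul, Complex.ofReal_add, Complex.exp_add]
    ring
  simp_rw [hpt]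
  rw [integral_const_mul, integral_prod_mul (f := fun x => Complex.exp (↑(2 * Real.pi * inner ℝ x η) * Complex.I) *
    approxDelta χ ε (z s - x)) (g := fun x => Complex.exp (↑(2 * Real.pi * inner ℝ x η') * Complex.I) *
    approxDelta χ ε (z s - x)), integral_exp_mul_approxDelta χ hε, integral_exp_mul_approxDelta χ hε]
  have hin : inner ℝ z (Conf.collapse s ζ) = inner ℝ z ζ.forget + (inner ℝ (z s) η + inner ℝ (z s) η') := by
    rw [Conf.collapse, inner_add_right, ← inner_add_right (z s), PiLp.inner_apply z (PiLp.single _ _ _),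
      Finset.sum_eq_single s]
    · simp [hη, hη']
    · intro b _ hb
      simp [hb]
    · simp
  rw [hin]
  simp only [mul_add, add_mul, Complex.ofReal_add, Complex.exp_add]
  ring

/-- The lift of a momentum of `k + 1` particles to the point of the space-time momentum space of `k`
particles at which the test function is evaluated after collapsing. -/
def collapseLift {k : ℕ} (s : Fin k ⊕ Fin k) (ζ : Conf (k + 1)) : STConf k :=
  WithLp.toLp 2 (ζ.symbol / (2 * Real.pi), ζ.collapse s)

/-- The mollified collapse of a free solution, computed on the Fourier side. -/
theorem integral_mollifiedPairing {k : ℕ} (s : Fin k ⊕ Fin k) {γ : ℝ → Conf (k + 1) → ℂ}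
    (hγ : IsFreeSolution γ) {γ₀ : 𝓢'(Conf (k + 1), ℂ)} (h₀ : Represents γ₀ (γ 0))
    {h : Conf (k + 1) → ℂ} (hh : Represents (𝓕 γ₀) h) (χ : 𝓢(R3, ℂ)) (Φ : 𝓢(STConf k, ℂ)) {ε : ℝ}
    (hε : 0 < ε) :
    Integrable (mollifiedPairing s γ χ Φ ε) ∧
    ∫ t, mollifiedPairing s γ χ Φ ε t = ∫ ζ, h ζ * ((𝓕 χ) (ε • ζ (Sum.inl (Fin.last k))) *
      (𝓕 χ) (ε • ζ (Sum.inr (Fin.last k))) * (𝓕⁻ Φ) (collapseLift s ζ)) := by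
  obtain ⟨Ψ, hΨ⟩ := exists_mollified s χ Φ hε
  have h1 : mollifiedPairing s γ χ Φ ε = fun t => ∫ ζ, Complex.exp ((t * ζ.symbol : ℝ) * Complex.I) *
      (h ζ * (𝓕⁻ (slice t Ψ)) ζ) := by
    funext t
    rw [← integral_mul_eq_integral_phase Conf.symbol_hasTemperateGrowth hγ.tempered deltaPM_fourier
      (fun φ t => hγ.equation φ t) h₀ hh]
    refine integral_congr_ae (Eventually.of_forall fun z => ?_)
    simp only [slice_apply, hΨ]
    ring
  have h2 := integral_phase_slice Conf.symbol_hasTemperateGrowth hh.1 Ψ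
  rw [h1]
  refine ⟨h2.1, h2.2.trans (integral_congr_ae (Eventually.of_forall fun ζ => ?_))⟩
  simp only
  congr 1
  rw [fourierInv_toLp Ψ, collapseLift, fourierInv_toLp Φ, ← integral_const_mul]
  refine integral_congr_ae (Eventually.of_forall fun t => ?_)
  simp only
  rw [fourierInv_mollified_slice s χ Φ hε hΨ]
  ring

/-! ### The weighted `L²` estimate for the collapsing map -/

/-- An affine substitution with slope at least `1` in absolute value decreases the integral. -/
theorem lintegral_comp_affine_le {c b : ℝ} (hc : 1 ≤ |c|) {g : ℝ → ENNReal} (hg : Measurable g) :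
    ∫⁻ a, g (c * (b + a)) ≤ ∫⁻ a, g a := by
  have hc0 : c ≠ 0 := by
    rintro rfl
    norm_num at hc
  have hm : Measurable fun a : ℝ => c * a := by fun_prop
  rw [lintegral_add_left_eq_self (fun a => g (c * a)) b]
  conv_rhs => rw [← Real.smul_map_volume_mul_left hc0, lintegral_smul_measure, lintegral_map hg hm]
  rw [smul_eq_mul]
  exact le_mul_of_one_le_left' (by simpa using hc)

namespace Conf

variable {k : ℕ}

@[fun_prop]
theorem continuous_glue : Continuous fun q : Conf k × R3 × R3 => glue q.1 q.2.1 q.2.2 :=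
  (splitEquiv k).symm.continuous.comp ((WithLp.prod_continuous_toLp 2 _ _).comp
    (continuous_fst.prodMk ((WithLp.prod_continuous_toLp 2 _ _).comp continuous_snd)))

theorem continuous_forget : Continuous (forget (k := k)) :=
  (PiLp.continuous_toLp 2 _).comp (continuous_pi fun s => by fun_prop)

theorem continuous_single_toLp (s : Fin k ⊕ Fin k) :
    Continuous fun v : R3 => (PiLp.single 2 s v : Conf k) := by
  refine (PiLp.continuous_toLp 2 _).comp ?_
  exact continuous_single (A := fun _ => R3) s

theorem continuous_collapse (s : Fin k ⊕ Fin k) : Continuous (collapse s) := by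
  exact continuous_forget.add ((continuous_single_toLp s).comp (by fun_prop))

theorem continuous_rieszSymbol : Continuous (rieszSymbol (k := k)) := by
  unfold rieszSymbol
  fun_prop

theorem continuous_symbol : Continuous (symbol (k := k)) := symbol_hasTemperateGrowth.1.continuous

/-- Integration in the momenta of the collapsed configuration. -/
theorem lintegral_eq_collapse (s : Fin k ⊕ Fin k) {G : Conf (k + 1) → ENNReal} (hG : Measurable G) :
    ∫⁻ ζ, G ζ = ∫⁻ ξ : Conf k, ∫⁻ x : R3, ∫⁻ x' : R3, G (glue (ξ - PiLp.single 2 s (x + x')) x x') := by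
  have hs : Continuous fun v : R3 => (PiLp.single 2 s v : Conf k) :=
    continuous_single_toLp s
  have hm : Measurable fun q : Conf k × R3 × R3 => G (glue q.1 q.2.1 q.2.2) :=
    hG.comp continuous_glue.measurable
  have hm' : Measurable fun q : Conf k × R3 × R3 =>
      G (glue (q.1 - PiLp.single 2 s (q.2.1 + q.2.2)) q.2.1 q.2.2) :=
    hm.comp (by fun_prop : Continuous fun q : Conf k × R3 × R3 =>
      (q.1 - PiLp.single 2 s (q.2.1 + q.2.2), q.2)).measurable
  have h1 : ∫⁻ ζ, G ζ = ∫⁻ q : R3 × R3, ∫⁻ z : Conf k, G (glue z q.1 q.2) := by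
    rw [← measurePreserving_glue.lintegral_comp hG, Measure.volume_eq_prod]
    exact lintegral_prod_symm _ hm.aemeasurable
  have h2 : ∫⁻ ξ : Conf k, ∫⁻ x : R3, ∫⁻ x' : R3, G (glue (ξ - PiLp.single 2 s (x + x')) x x') =
      ∫⁻ q : Conf k × R3 × R3, G (glue (q.1 - PiLp.single 2 s (q.2.1 + q.2.2)) q.2.1 q.2.2) := by
    rw [Measure.volume_eq_prod, lintegral_prod _ hm'.aemeasurable]
    refine lintegral_congr fun ξ => ?_
    exact (lintegral_prod _ (hm'.comp measurable_prodMk_left).aemeasurable).symm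
  have h3 : ∫⁻ q : Conf k × R3 × R3, G (glue (q.1 - PiLp.single 2 s (q.2.1 + q.2.2)) q.2.1 q.2.2) =
      ∫⁻ q : R3 × R3, ∫⁻ ξ : Conf k, G (glue (ξ - PiLp.single 2 s (q.1 + q.2)) q.1 q.2) :=
    lintegral_prod_symm _ hm'.aemeasurable
  rw [h1, h2, h3]
  refine lintegral_congr fun q => ?_
  exact (lintegral_sub_right_eq_self (fun z : Conf k => G (glue z q.1 q.2)) _).symm

/-- The ratio of the symbols of `R^{(k)}` at the collapsed momentum and of `R^{(k+1)}`. -/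
def weight (s : Fin k ⊕ Fin k) (ζ : Conf (k + 1)) : ℝ :=
  rieszSymbol (ζ.collapse s) / rieszSymbol ζ

theorem measurable_weight (s : Fin k ⊕ Fin k) : Measurable (weight s) :=
  (continuous_rieszSymbol.comp (continuous_collapse s)).measurable.div
    continuous_rieszSymbol.measurable

/-- The factors `‖ξ_t‖`, `t ≠ s`, cancel in the weight. Where one of them vanishes both symbols are `0`,
and `0 / 0 = 0` keeps the bound true; the factors `2π` are discarded. -/
theorem weight_glue_sq_le (s : Fin k ⊕ Fin k) (ξ : Conf k) (x x' : R3) :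
    weight s (glue (ξ - PiLp.single 2 s (x + x')) x x') ^ 2 ≤
      ‖ξ s‖ ^ 2 / (‖x‖ ^ 2 * ‖x'‖ ^ 2 * ‖ξ s - x - x'‖ ^ 2) := by
  classical
  set A : ℝ := ∏ t ∈ Finset.univ.erase s, (2 * Real.pi * ‖ξ t‖) with hA
  have hnum : rieszSymbol ξ = 2 * Real.pi * ‖ξ s‖ * A :=
    (Finset.mul_prod_erase Finset.univ (fun t => 2 * Real.pi * ‖ξ t‖) (Finset.mem_univ s)).symm
  have hden : rieszSymbol (glue (ξ - PiLp.single 2 s (x + x')) x x') =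
      2 * Real.pi * ‖ξ s - x - x'‖ * A * ((2 * Real.pi * ‖x‖) * (2 * Real.pi * ‖x'‖)) := by
    unfold rieszSymbol
    rw [prod_eq_forget]
    simp only [← forget_apply, forget_glue, glue_inl_last, glue_inr_last]
    congr 1
    rw [← Finset.mul_prod_erase Finset.univ _ (Finset.mem_univ s), hA]
    congr 1
    · simp [sub_sub]
    · refine Finset.prod_congr rfl fun t ht => ?_
      simp [Finset.ne_of_mem_erase ht]
  rw [weight, hden, collapse_glue, sub_add_cancel, hnum]
  rcases eq_or_ne A 0 with h0 | h0
  · rw [h0]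
    simp only [mul_zero, zero_mul, zero_div, ne_eq, OfNat.ofNat_ne_zero, not_false_eq_true, zero_pow]
    positivity
  have hpi := Real.pi_pos
  have hpi1 : (1 : ℝ) ≤ (2 * Real.pi) ^ 4 := one_le_pow₀ (by linarith [Real.pi_gt_three])
  have heq : (2 * Real.pi * ‖ξ s‖ * A /
      (2 * Real.pi * ‖ξ s - x - x'‖ * A * ((2 * Real.pi * ‖x‖) * (2 * Real.pi * ‖x'‖)))) ^ 2 =
      ‖ξ s‖ ^ 2 / (‖x‖ ^ 2 * ‖x'‖ ^ 2 * ‖ξ s - x - x'‖ ^ 2) / (2 * Real.pi) ^ 4 := by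
    rw [show 2 * Real.pi * ‖ξ s‖ * A = (2 * Real.pi * A) * ‖ξ s‖ by ring,
      show 2 * Real.pi * ‖ξ s - x - x'‖ * A * ((2 * Real.pi * ‖x‖) * (2 * Real.pi * ‖x'‖)) =
        (2 * Real.pi * A) * (‖x‖ * ‖x'‖ * ‖ξ s - x - x'‖ * (2 * Real.pi) ^ 2) by ring,
      mul_div_mul_left _ _ (by positivity), div_pow, div_div]
    ring
  rw [heq]
  exact div_le_self (by positivity) hpi1

end Conf

open Conf

variable {k : ℕ}

theorem continuous_collapseLift (s : Fin k ⊕ Fin k) : Continuous (collapseLift s) :=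
  (WithLp.prod_continuous_toLp 2 _ _).comp
    ((continuous_symbol.div_const _).prodMk (continuous_collapse s))

/-- The time frequency of the lift as an affine function, of slope `-2π`, of the phase in
`collapseIntegrand`. -/
theorem collapseLift_glue (s : Fin k ⊕ Fin k) (ξ : Conf k) (x x' : R3) :
    collapseLift s (glue (ξ - PiLp.single 2 s (x + x')) x x') =
      WithLp.toLp 2 (-(2 * Real.pi) *
        ((kinetic ξ - Sum.elim (fun _ => 1) (fun _ => -1) s * ‖ξ s‖ ^ 2) +
          (1 * ‖x‖ ^ 2 + -1 * ‖x'‖ ^ 2 +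
            Sum.elim (fun _ => 1) (fun _ => -1) s * ‖ξ s - x - x'‖ ^ 2)), ξ) := by
  rw [collapseLift, collapse_glue, sub_add_cancel, symbol, kinetic_glue, kinetic_sub_single,
    ← sub_sub]
  congr 2
  have := Real.pi_pos.ne'
  field_simp
  ring

/-- The weighted pullback along `collapseLift` is bounded on integrals of nonnegative functions; this is
the `L²` estimate behind the theorem. -/
theorem lintegral_weight_mul_collapseLift_le (s : Fin k ⊕ Fin k) {Θ : STConf k → ENNReal}
    (hΘ : Measurable Θ) :
    ∫⁻ ζ, ENNReal.ofReal (weight s ζ ^ 2) * Θ (collapseLift s ζ) ≤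
      ENNReal.ofReal (1728 * Real.pi ^ 2) * ∫⁻ w, Θ w := by
  have hmp := WithLp.volume_preserving_toLp ℝ (Conf k)
  have hΘ' : Measurable fun q : ℝ × Conf k => Θ (WithLp.toLp 2 q) := hΘ.comp hmp.measurable
  have hR : ∫⁻ w, Θ w = ∫⁻ ξ : Conf k, ∫⁻ a : ℝ, Θ (WithLp.toLp 2 (a, ξ)) := by
    rw [← hmp.lintegral_comp hΘ, Measure.volume_eq_prod, lintegral_prod_symm _ hΘ'.aemeasurable]
  have hG : Measurable fun ζ => ENNReal.ofReal (weight s ζ ^ 2) * Θ (collapseLift s ζ) :=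
    ((measurable_weight s).pow_const 2).ennreal_ofReal.mul
      (hΘ.comp (continuous_collapseLift s).measurable)
  rw [lintegral_eq_collapse s hG, hR, ← lintegral_const_mul']
  swap
  · exact ENNReal.ofReal_ne_top
  refine lintegral_mono fun ξ => ?_
  set c : ℝ := kinetic ξ - Sum.elim (fun _ => 1) (fun _ => -1) s * ‖ξ s‖ ^ 2 with hc
  have hξ : Measurable fun a : ℝ => Θ (WithLp.toLp 2 (a, ξ)) := hΘ'.comp measurable_prodMk_right
  have hpi : 1 ≤ |-(2 * Real.pi)| := by
    rw [abs_neg, abs_of_pos (by positivity)]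
    linarith [Real.pi_gt_three]
  calc _ ≤ ∫⁻ x, ∫⁻ x', collapseIntegrand (fun a => Θ (WithLp.toLp 2 (-(2 * Real.pi) * (c + a), ξ)))
        ‖ξ s‖ 1 (-1) (Sum.elim (fun _ => 1) (fun _ => -1) s) x x' (ξ s - x - x') := by
        refine lintegral_mono fun x => lintegral_mono fun x' => ?_
        rw [collapseLift_glue, collapseIntegrand]
        gcongr
        exact weight_glue_sq_le s ξ x x'
    _ ≤ ENNReal.ofReal (1728 * Real.pi ^ 2) *
        ∫⁻ a, Θ (WithLp.toLp 2 (-(2 * Real.pi) * (c + a), ξ)) :=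
        lintegral_collapseIntegrand_le
          (hξ.comp (by fun_prop : Measurable fun a : ℝ => -(2 * Real.pi) * (c + a)))
          (Or.inl rfl) (Or.inr rfl) (by rcases s with i | i <;> simp) _
    _ ≤ _ := mul_le_mul' le_rfl (lintegral_comp_affine_le hpi hξ)

/-! ### Null sets -/

theorem ae_linearMap_ne_zero {V F : Type*} [NormedAddCommGroup V] [InnerProductSpace ℝ V]
    [FiniteDimensional ℝ V] [MeasurableSpace V] [BorelSpace V] [AddCommGroup F] [Module ℝ F]
    {L : V →ₗ[ℝ] F} (hL : L ≠ 0) : ∀ᵐ v, L v ≠ 0 := by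
  have h := Measure.addHaar_submodule (volume : Measure V) (LinearMap.ker L) fun h =>
    hL (LinearMap.ker_eq_top.1 h)
  rw [ae_iff]
  simp only [ne_eq, not_not]
  exact h

theorem rieszSymbol_ne_zero {ξ : Conf k} (h : ∀ s, ξ s ≠ 0) : rieszSymbol ξ ≠ 0 :=
  Finset.prod_ne_zero_iff.2 fun s _ => by simp [h s, Real.pi_ne_zero]

theorem ae_rieszSymbol_ne_zero : ∀ᵐ ξ : Conf k, rieszSymbol ξ ≠ 0 := by
  have h : ∀ s : Fin k ⊕ Fin k, ∀ᵐ ξ : Conf k, ξ s ≠ 0 := fun s => by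
    refine ae_linearMap_ne_zero (L := ((PiLp.proj 2 (fun _ => R3) s : Conf k →L[ℝ] R3) : Conf k →ₗ[ℝ] R3)) fun h0 => ?_
    have := LinearMap.congr_fun h0 (Conf.unit s 0)
    simp [Conf.unit] at this
  filter_upwards [ae_all_iff.2 h] with ξ hξ using rieszSymbol_ne_zero hξ

theorem ae_rieszSymbol_snd_ne_zero : ∀ᵐ w : STConf k, rieszSymbol w.snd ≠ 0 := by
  have h := (WithLp.volume_preserving_ofLp ℝ (Conf k)).quasiMeasurePreserving
  exact h.ae (Measure.quasiMeasurePreserving_snd.ae ae_rieszSymbol_ne_zero)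

theorem ae_rieszSymbol_collapse_ne_zero (s : Fin k ⊕ Fin k) :
    ∀ᵐ ζ : Conf (k + 1), rieszSymbol (ζ.collapse s) ≠ 0 := by
  let L (t : Fin k ⊕ Fin k) : Conf (k + 1) →ₗ[ℝ] R3 :=
    { toFun := fun ζ => ζ.collapse s t
      map_add' := fun ζ ζ' => by
        simp only [collapse, forget_add, PiLp.add_apply, PiLp.single_add]
        abel
      map_smul' := fun c ζ => by
        have h1 (v : R3) : (PiLp.single 2 s (c • v) : Conf k) = c • PiLp.single 2 s v :=
          congrArg (WithLp.toLp 2) (Pi.single_smul (f := fun _ => R3) s c v)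
        simp only [collapse, forget_smul, PiLp.add_apply, PiLp.smul_apply, ← smul_add, h1,
          RingHom.id_apply] }
  have h : ∀ t : Fin k ⊕ Fin k, ∀ᵐ ζ : Conf (k + 1), ζ.collapse s t ≠ 0 := fun t => by
    refine ae_linearMap_ne_zero (L := L t) fun h0 => ?_
    have : (glue (Conf.unit t 0) 0 0).collapse s t = 0 := LinearMap.congr_fun h0 _
    rw [collapse_glue] at this
    simp [Conf.unit] at this
  filter_upwards [ae_all_iff.2 h] with ζ hζ using rieszSymbol_ne_zero hζ

theorem ae_weight_ne_zero (s : Fin k ⊕ Fin k) : ∀ᵐ ζ, weight s ζ ≠ 0 := by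
  filter_upwards [ae_rieszSymbol_ne_zero, ae_rieszSymbol_collapse_ne_zero s] with ζ h1 h2
  exact div_ne_zero h2 h1

/-- The preimage of a null set is null, because the weight is nonzero almost everywhere in the estimate
`lintegral_weight_mul_collapseLift_le`. -/
theorem quasiMeasurePreserving_collapseLift (s : Fin k ⊕ Fin k) :
    Measure.QuasiMeasurePreserving (collapseLift s) volume volume := by
  refine ⟨(continuous_collapseLift s).measurable, Measure.AbsolutelyContinuous.mk fun N hN h0 => ?_⟩
  rw [Measure.map_apply (continuous_collapseLift s).measurable hN]
  have h := lintegral_weight_mul_collapseLift_le s (measurable_const.indicator hN : Measurable (N.indicator fun _ => (1 : ENNReal)))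
  rw [lintegral_indicator_const hN, h0, one_mul, mul_zero, nonpos_iff_eq_zero, lintegral_eq_zero_iff] at h
  · refine measure_eq_zero_iff_ae_notMem.2 ?_
    filter_upwards [h, ae_weight_ne_zero s] with ζ hζ hw hmem
    rw [Set.indicator_of_mem (s := N) hmem] at hζ
    have : 0 < weight s ζ ^ 2 := by positivity
    simp [hw] at hζ
  · exact (((measurable_weight s).pow_const 2).ennreal_ofReal.mul
      ((measurable_const.indicator hN).comp (continuous_collapseLift s).measurable))

/-! ### Integrability of the inverse symbol -/

theorem integrable_inv_norm_sq_mul : Integrable fun x : R3 => (‖x‖ ^ 2)⁻¹ * ((1 + ‖x‖) ^ 2)⁻¹ := by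
  have h := integrable_fun_norm_addHaar (volume : Measure R3)
    (f := fun r : ℝ => (r ^ 2)⁻¹ * ((1 + r) ^ 2)⁻¹)
  refine h.2 ?_
  rw [finrank_euclideanSpace_fin]
  refine Integrable.mono' (integrable_inv_one_add_sq.integrableOn (s := Set.Ioi 0)) ?_ ?_
  · exact (by fun_prop : Measurable _).aestronglyMeasurable
  · filter_upwards [ae_restrict_mem measurableSet_Ioi] with r hr
    have hr : 0 < r := hr
    rw [smul_eq_mul, show 3 - 1 = 2 from rfl, mul_inv_cancel_left₀ (by positivity),
      Real.norm_of_nonneg (by positivity)]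
    gcongr
    nlinarith

theorem Conf.integrable_prod_apply (k : ℕ) {f : R3 → ℝ} (hf : Integrable f) :
    Integrable fun ξ : Conf k => ∏ s, f (ξ s) := by
  induction k with
  | zero => simp
  | succ k ih =>
    rw [← measurePreserving_glue.integrable_comp_emb measurableEmbedding_glue]
    refine (ih.mul_prod (hf.mul_prod hf)).congr (Eventually.of_forall fun q => ?_)
    simp only [Function.comp, prod_eq_forget, ← forget_apply, forget_glue, glue_inl_last,
      glue_inr_last]

/-- The singularities `‖ξ_s‖⁻²` of the squared inverse symbol are integrable in `ℝ³`. -/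
theorem memLp_inv_rieszSymbol : ∃ N : ℕ, MemLp (fun w : STConf k =>
    (rieszSymbol w.snd)⁻¹ * ((1 + ‖w‖) ^ N)⁻¹) 2 := by
  refine ⟨1 + Fintype.card (Fin k ⊕ Fin k), ?_⟩
  have hmeas : AEStronglyMeasurable (fun w : STConf k => (rieszSymbol w.snd)⁻¹ *
      ((1 + ‖w‖) ^ (1 + Fintype.card (Fin k ⊕ Fin k)))⁻¹) volume := by
    have h1 : Continuous fun w : STConf k => rieszSymbol w.snd :=
      continuous_rieszSymbol.comp (WithLp.sndL 2 ℝ ℝ (Conf k)).continuous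
    have h2 : Continuous fun w : STConf k => (1 + ‖w‖) ^ (1 + Fintype.card (Fin k ⊕ Fin k)) := by
      fun_prop
    exact (h1.measurable.inv.mul h2.measurable.inv).aestronglyMeasurable
  rw [memLp_two_iff_integrable_sq hmeas]
  have hB : Integrable fun w : STConf k => (1 + w.fst ^ 2)⁻¹ *
      ∏ s, ((‖w.snd s‖ ^ 2)⁻¹ * ((1 + ‖w.snd s‖) ^ 2)⁻¹) :=
    (WithLp.volume_preserving_ofLp ℝ (Conf k)).integrable_comp_of_integrable
      (integrable_inv_one_add_sq.mul_prod (Conf.integrable_prod_apply k integrable_inv_norm_sq_mul))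
  refine hB.mono' (hmeas.pow 2) (Eventually.of_forall fun w => ?_)
  have hfst : ‖w.fst‖ ≤ ‖w‖ := WithLp.norm_fst_le _ w
  have hsnd : ∀ s, ‖w.snd s‖ ≤ ‖w‖ := fun s =>
    (PiLp.norm_apply_le w.snd s).trans (WithLp.norm_snd_le _ w)
  rw [Real.norm_of_nonneg (by positivity), mul_pow, inv_pow, inv_pow, Finset.prod_mul_distrib,
    mul_left_comm, Finset.prod_inv_distrib, Finset.prod_inv_distrib]
  have h1 : ∏ s, ‖w.snd s‖ ^ 2 ≤ rieszSymbol w.snd ^ 2 := by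
    rw [rieszSymbol, ← Finset.prod_pow]
    refine Finset.prod_le_prod (fun s _ => by positivity) fun s _ => ?_
    gcongr
    exact le_mul_of_one_le_left (norm_nonneg _) (by linarith [Real.pi_gt_three])
  have h2 : (1 + w.fst ^ 2) * ∏ s, (1 + ‖w.snd s‖) ^ 2 ≤
      ((1 + ‖w‖) ^ (1 + Fintype.card (Fin k ⊕ Fin k))) ^ 2 := by
    rw [← pow_mul, mul_comm (1 + _) 2, pow_mul, pow_add, pow_one]
    refine mul_le_mul ?_ ?_ (by positivity) (by positivity)
    · have : w.fst ^ 2 ≤ ‖w‖ ^ 2 := by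
        rw [← sq_abs]
        gcongr
        exact hfst
      nlinarith [norm_nonneg w]
    · refine (Finset.prod_le_prod (fun s _ => by positivity) fun s _ => ?_).trans_eq
        (Finset.prod_const _)
      gcongr
      exact hsnd s
  have h3 : 0 < (1 + w.fst ^ 2) * ∏ s, (1 + ‖w.snd s‖) ^ 2 :=
    mul_pos (by positivity) (Finset.prod_pos fun s _ => by positivity)
  rcases (Finset.prod_nonneg fun s _ => by positivity : 0 ≤ ∏ s, ‖w.snd s‖ ^ 2).eq_or_lt with h0 | h0
  -- if some `‖ξ_s‖` vanishes, both sides are `0` because `0⁻¹ = 0`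
  · obtain ⟨s, -, hs⟩ := Finset.prod_eq_zero_iff.1 h0.symm
    have hz : rieszSymbol w.snd = 0 :=
      Finset.prod_eq_zero (Finset.mem_univ s) (by rw [(pow_eq_zero_iff two_ne_zero).1 hs, mul_zero])
    rw [hz, ← h0]
    simp
  · rw [← mul_inv (1 + w.fst ^ 2)]
    exact mul_le_mul (inv_anti₀ h0 h1) (inv_anti₀ h3 h2) (by positivity) (by positivity)

/-! ### Duality and removal of the mollification -/

section WeightedComposition

variable {X Y : Type*} [MeasurableSpace X] [MeasurableSpace Y] {μ : Measure X} {ν : Measure Y}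

/-- If the weighted pullback `Θ ↦ W² Θ ∘ π` is bounded on integrals, the operator `g ↦ W g ∘ π` is
bounded from `L²(ν)` to `L²(μ)`. -/
theorem exists_weighted_comp {π : X → Y} {W : X → ℝ} {C : ℝ} (hC : 0 ≤ C)
    (hW : Measurable W) (hπ : Measure.QuasiMeasurePreserving π μ ν)
    (h : ∀ Θ : Y → ENNReal, Measurable Θ →
      ∫⁻ x, ENNReal.ofReal (W x ^ 2) * Θ (π x) ∂μ ≤ ENNReal.ofReal C * ∫⁻ y, Θ y ∂ν) :
    ∃ A : Lp ℂ 2 ν →L[ℂ] Lp ℂ 2 μ, ‖A‖ ≤ √C ∧ ∀ g, A g =ᵐ[μ] fun x => (W x : ℂ) * g (π x) := by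
  have hmeas : ∀ g : Lp ℂ 2 ν, AEStronglyMeasurable (fun x => (W x : ℂ) * g (π x)) μ := fun g =>
    (Complex.measurable_ofReal.comp hW).aestronglyMeasurable.mul
      ((Lp.stronglyMeasurable g).comp_measurable hπ.measurable).aestronglyMeasurable
  have hnorm : ∀ g : Lp ℂ 2 ν,
      eLpNorm (fun x => (W x : ℂ) * g (π x)) 2 μ ≤ ENNReal.ofReal √C * eLpNorm g 2 ν := by
    intro g
    have h1 := h (fun y => ‖g y‖ₑ ^ (2 : ℝ)) ((Lp.stronglyMeasurable g).enorm.pow_const 2)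
    rw [eLpNorm_eq_lintegral_rpow_enorm_toReal two_ne_zero ENNReal.ofNat_ne_top,
      eLpNorm_eq_lintegral_rpow_enorm_toReal two_ne_zero ENNReal.ofNat_ne_top, ENNReal.toReal_ofNat,
      Real.sqrt_eq_rpow, ← ENNReal.ofReal_rpow_of_nonneg hC (by norm_num),
      ← ENNReal.mul_rpow_of_nonneg _ _ (by norm_num)]
    refine ENNReal.rpow_le_rpow (le_trans (le_of_eq (lintegral_congr fun x => ?_)) h1) (by norm_num)
    rw [enorm_mul, ENNReal.mul_rpow_of_nonneg _ _ (by norm_num)]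
    congr 1
    rw [← ofReal_norm, Complex.norm_real, ENNReal.ofReal_rpow_of_nonneg (norm_nonneg _) (by norm_num),
      Real.rpow_two, Real.norm_eq_abs, sq_abs]
  have hmem : ∀ g : Lp ℂ 2 ν, MemLp (fun x => (W x : ℂ) * g (π x)) 2 μ := fun g =>
    ⟨hmeas g, (hnorm g).trans_lt (ENNReal.mul_lt_top ENNReal.ofReal_lt_top (Lp.eLpNorm_lt_top g))⟩
  let A₀ : Lp ℂ 2 ν →ₗ[ℂ] Lp ℂ 2 μ :=
    { toFun := fun g => (hmem g).toLp
      map_add' := fun f g => by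
        rw [← MemLp.toLp_add]
        refine MemLp.toLp_congr _ _ ?_
        filter_upwards [hπ.ae (Lp.coeFn_add f g)] with x hx
        rw [hx]
        simp only [Pi.add_apply, mul_add]
      map_smul' := fun c g => by
        rw [RingHom.id_apply, ← MemLp.toLp_const_smul]
        refine MemLp.toLp_congr _ _ ?_
        filter_upwards [hπ.ae (Lp.coeFn_smul c g)] with x hx
        rw [hx]
        simp only [Pi.smul_apply, smul_eq_mul]
        ring }
  have hA₀ : ∀ g, ‖A₀ g‖ ≤ √C * ‖g‖ := fun g => by
    have h1 := ENNReal.toReal_mono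
      (ENNReal.mul_ne_top ENNReal.ofReal_ne_top (Lp.eLpNorm_ne_top g)) (hnorm g)
    rw [ENNReal.toReal_mul, ENNReal.toReal_ofReal (Real.sqrt_nonneg C)] at h1
    rw [Lp.norm_def g]
    exact (Lp.norm_toLp _ (hmem g)).trans_le h1
  exact ⟨A₀.mkContinuous _ hA₀, LinearMap.mkContinuous_norm_le _ (Real.sqrt_nonneg C) _,
    fun g => (hmem g).coeFn_toLp⟩

theorem inner_star_eq_integral_mul (f g : Lp ℂ 2 μ) : inner ℂ (star f) g = ∫ x, f x * g x ∂μ := by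
  rw [L2.inner_def]
  refine integral_congr_ae ?_
  filter_upwards [Lp.coeFn_star f] with x hx
  rw [hx]
  simp [mul_comm]

theorem integrable_mul_of_L2 (f g : Lp ℂ 2 μ) : Integrable (fun x => f x * g x) μ :=
  (Lp.memLp f).integrable_mul (Lp.memLp g)

theorem norm_star_L2 (f : Lp ℂ 2 μ) : ‖star f‖ = ‖f‖ := by
  rw [Lp.norm_def, Lp.norm_def]
  congr 1
  refine eLpNorm_congr_norm_ae ?_
  filter_upwards [Lp.coeFn_star f] with x hx
  rw [hx, Pi.star_apply, norm_star]

/-- The transpose of `g ↦ W g ∘ π` with respect to the bilinear `L²` pairing. -/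
theorem exists_transpose {A : Lp ℂ 2 ν →L[ℂ] Lp ℂ 2 μ} (G : Lp ℂ 2 μ) :
    ∃ K : Lp ℂ 2 ν, ‖K‖ ≤ ‖A‖ * ‖G‖ ∧ ∀ g, ∫ x, G x * A g x ∂μ = ∫ y, K y * g y ∂ν := by
  refine ⟨star (A.adjoint (star G)), ?_, fun g => ?_⟩
  · rw [norm_star_L2, ← norm_star_L2 G, ← LinearIsometryEquiv.norm_map ContinuousLinearMap.adjoint A]
    exact ContinuousLinearMap.le_opNorm _ _
  · rw [← inner_star_eq_integral_mul, ← inner_star_eq_integral_mul, star_star,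
      ContinuousLinearMap.adjoint_inner_left]

end WeightedComposition

open Conf

variable {k : ℕ}

/-- A solution of `m h = K` with `K ∈ L²` and `m` the symbol of `R^{(k)}` is tempered. -/
theorem temperedFun_div_rieszSymbol (K : Lp ℂ 2 (volume : Measure (STConf k))) :
    TemperedFun fun w : STConf k => (rieszSymbol w.snd : ℂ)⁻¹ * K w := by
  obtain ⟨N, hN⟩ := memLp_inv_rieszSymbol (k := k)
  refine ⟨N, ((hN.ofReal (K := ℂ)).integrable_mul (Lp.memLp K)).congr (Eventually.of_forall fun w => ?_)⟩
  have hc : ∀ r : ℝ, (RCLike.ofReal r : ℂ) = (r : ℂ) := fun _ => rfl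
  simp only [Pi.mul_apply, Complex.real_smul, hc]
  push_cast
  ring

theorem memLp_schwartz_div_rieszSymbol (Θ : 𝓢(STConf k, ℂ)) :
    MemLp (fun w : STConf k => (rieszSymbol w.snd : ℂ)⁻¹ * Θ w) 2 := by
  obtain ⟨N, hN⟩ := memLp_inv_rieszSymbol (k := k)
  obtain ⟨C, hC0, hC⟩ := (SchwartzBounded.of_single Θ).decay N
  have hm : AEStronglyMeasurable (fun w : STConf k => (rieszSymbol w.snd : ℂ)⁻¹ * Θ w) volume := by
    have h1 : Continuous fun w : STConf k => (rieszSymbol w.snd : ℂ) :=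
      Complex.continuous_ofReal.comp
        (continuous_rieszSymbol.comp (WithLp.sndL 2 ℝ ℝ (Conf k)).continuous)
    exact (h1.measurable.inv.mul Θ.continuous.measurable).aestronglyMeasurable
  refine (hN.const_mul C).mono hm (Eventually.of_forall fun w => ?_)
  have h := hC () w
  rw [norm_mul, norm_mul, norm_mul, norm_inv, norm_inv, norm_inv, Complex.norm_real,
    Real.norm_of_nonneg hC0, Real.norm_of_nonneg (by positivity : 0 ≤ (1 + ‖w‖) ^ N)]
  calc _ ≤ ‖rieszSymbol w.snd‖⁻¹ * (C * ((1 + ‖w‖) ^ N)⁻¹) := by gcongr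
    _ = _ := by ring

/-- A function `h` on momentum space with `R h ∈ L²` restricts to the
characteristic surface, in the sense that integrating against lifted test functions is integration
against a function `H` with `R H ∈ L²`. -/
theorem exists_collapse_representative (s : Fin k ⊕ Fin k) {h : Conf (k + 1) → ℂ}
    (G : Lp ℂ 2 (volume : Measure (Conf (k + 1))))
    (hG : G =ᵐ[volume] fun ζ => (rieszSymbol ζ : ℂ) * h ζ) :
    ∃ K : Lp ℂ 2 (volume : Measure (STConf k)), ‖K‖ ≤ √(1728 * Real.pi ^ 2) * ‖G‖ ∧
      ∀ Θ : 𝓢(STConf k, ℂ), Integrable (fun ζ => h ζ * Θ (collapseLift s ζ)) ∧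
        ∫ ζ, h ζ * Θ (collapseLift s ζ) = ∫ w, (rieszSymbol w.snd : ℂ)⁻¹ * K w * Θ w := by
  obtain ⟨A, hA, hAg⟩ := exists_weighted_comp (by positivity) (measurable_weight s)
    (quasiMeasurePreserving_collapseLift s) (fun Θ hΘ => lintegral_weight_mul_collapseLift_le s hΘ)
  obtain ⟨K, hK, hKg⟩ := exists_transpose (A := A) G
  refine ⟨K, hK.trans (by gcongr), fun Θ => ?_⟩
  have hmem := memLp_schwartz_div_rieszSymbol Θ
  have heq : (fun ζ => G ζ * A hmem.toLp ζ) =ᵐ[volume] fun ζ => h ζ * Θ (collapseLift s ζ) := by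
    filter_upwards [hG, hAg hmem.toLp,
      (quasiMeasurePreserving_collapseLift s).ae hmem.coeFn_toLp,
      ae_rieszSymbol_ne_zero, ae_rieszSymbol_collapse_ne_zero s] with ζ h1 h2 h3 h4 h5
    have h4' : (rieszSymbol ζ : ℂ) ≠ 0 := Complex.ofReal_ne_zero.2 h4
    have h5' : (rieszSymbol (ζ.collapse s) : ℂ) ≠ 0 := Complex.ofReal_ne_zero.2 h5
    have h6 : (collapseLift s ζ).snd = ζ.collapse s := rfl
    rw [h1, h2, h3, h6, weight]
    push_cast
    field_simp
  refine ⟨(integrable_mul_of_L2 G (A hmem.toLp)).congr heq, ?_⟩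
  rw [← integral_congr_ae heq, hKg]
  refine integral_congr_ae ?_
  filter_upwards [hmem.coeFn_toLp] with w hw
  rw [hw]
  ring

/-- Removing the mollification on the Fourier side, where `δ_ε` becomes `χ̂(ε ·)`. -/
theorem tendsto_integral_mollifier {χ : 𝓢(R3, ℂ)} (hχ : ∫ y, χ y = 1) (a b : Fin k ⊕ Fin k)
    {g : Conf k → ℂ} (hg : Integrable g) :
    Tendsto (fun ε : ℝ => ∫ ζ : Conf k, (𝓕 χ) (ε • ζ a) * (𝓕 χ) (ε • ζ b) * g ζ) (𝓝[>] 0)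
      (𝓝 (∫ ζ, g ζ)) := by
  obtain ⟨B, hB0, hB⟩ := (SchwartzBounded.of_single (𝓕 χ)).decay 0
  simp only [pow_zero, inv_one, mul_one] at hB
  refine tendsto_integral_filter_of_dominated_convergence (fun ζ => B * B * ‖g ζ‖)
    (Eventually.of_forall fun ε => ?_)
    (Eventually.of_forall fun ε => Eventually.of_forall fun ζ => ?_)
    (hg.norm.const_mul _) (Eventually.of_forall fun ζ => ?_)
  · have h2 : ∀ t, Continuous fun ζ : Conf k => (𝓕 χ) (ε • ζ t) := fun t =>
      (𝓕 χ).continuous.comp (by fun_prop)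
    exact ((h2 a).mul (h2 b)).aestronglyMeasurable.mul hg.1
  · rw [norm_mul, norm_mul]
    gcongr
    · exact hB () _
    · exact hB () _
  · have h0 : (𝓕 χ) 0 = 1 := by
      rw [SchwartzMap.fourier_coe, Real.fourier_eq', ← hχ]
      simp
    have h1 : ∀ t, Tendsto (fun ε : ℝ => (𝓕 χ) (ε • ζ t)) (𝓝[>] 0) (𝓝 1) := fun t => by
      have hc : Continuous fun ε : ℝ => (𝓕 χ) (ε • ζ t) := (𝓕 χ).continuous.comp (by fun_prop)
      have := hc.tendsto 0
      rw [zero_smul, h0] at this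
      exact this.mono_left nhdsWithin_le_nhds
    simpa using ((h1 a).mul (h1 b)).mul_const (g ζ)

/-- The collapse of a free solution exists and is controlled in `L²` after
applying `R^{(k)}`. -/
theorem exists_isCollapse (s : Fin k ⊕ Fin k) {γ : ℝ → Conf (k + 1) → ℂ}
    (hγ : IsFreeSolution γ) {γ₀ : 𝓢'(Conf (k + 1), ℂ)} (h₀ : Represents γ₀ (γ 0))
    {G₀ : Lp ℂ 2 (volume : Measure (Conf (k + 1)))} (hR : IsR γ₀ G₀) :
    ∃ (T : 𝓢'(STConf k, ℂ)) (F : Lp ℂ 2 (volume : Measure (STConf k))),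
      IsCollapse s γ T ∧ IsSTR T F ∧ ‖F‖ ≤ √(1728 * Real.pi ^ 2) * ‖G₀‖ := by
  obtain ⟨h, hh, hG⟩ := hR
  obtain ⟨K, hK, hKΘ⟩ := exists_collapse_representative s _ hG
  rw [Lp.norm_fourier_eq] at hK
  have hH := temperedFun_div_rieszSymbol K
  obtain ⟨hHint, T₀, hT₀⟩ := hH.exists_clm
  let TH : 𝓢'(STConf k, ℂ) := ContinuousLinearMap.toPointwiseConvergenceCLM ℂ (RingHom.id ℂ) _ _ T₀
  have hTH : ∀ φ, TH φ = ∫ w, (rieszSymbol w.snd : ℂ)⁻¹ * K w * φ w := hT₀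
  refine ⟨𝓕⁻ TH, 𝓕⁻ K, fun χ hχ Φ => ?_, ⟨_, ⟨hH, fun φ => ?_⟩, ?_⟩, ?_⟩
  · refine ⟨fun ε hε => (integral_mollifiedPairing s hγ h₀ hh χ Φ hε).1, ?_⟩
    rw [TemperedDistribution.fourierInv_apply, hTH, ← (hKΘ (𝓕⁻ Φ)).2]
    refine (tendsto_integral_mollifier hχ (Sum.inl (Fin.last k)) (Sum.inr (Fin.last k))
      (hKΘ (𝓕⁻ Φ)).1).congr' ?_
    filter_upwards [self_mem_nhdsWithin] with ε hε
    rw [(integral_mollifiedPairing s hγ h₀ hh χ Φ hε).2]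
    refine integral_congr_ae (Eventually.of_forall fun ζ => ?_)
    simp only
    ring
  · rw [FourierTransform.fourier_fourierInv_eq, hTH]
  · rw [FourierTransform.fourier_fourierInv_eq]
    filter_upwards [ae_rieszSymbol_snd_ne_zero] with w hw
    rw [mul_inv_cancel_left₀ (Complex.ofReal_ne_zero.2 hw)]
  · rwa [← Lp.norm_fourier_eq, FourierTransform.fourier_fourierInv_eq]

theorem IsMultiplierImage.sub {V : Type*} [NormedAddCommGroup V] [InnerProductSpace ℝ V]
    [FiniteDimensional ℝ V] [MeasurableSpace V] [BorelSpace V] {m : V → ℝ} {T₁ T₂ : 𝓢'(V, ℂ)}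
    {F₁ F₂ : Lp ℂ 2 (volume : Measure V)} (h₁ : IsMultiplierImage m T₁ F₁)
    (h₂ : IsMultiplierImage m T₂ F₂) : IsMultiplierImage m (T₁ - T₂) (F₁ - F₂) := by
  obtain ⟨g₁, hg₁, hF₁⟩ := h₁
  obtain ⟨g₂, hg₂, hF₂⟩ := h₂
  refine ⟨fun ξ => g₁ ξ - g₂ ξ, ⟨?_, fun φ => ?_⟩, ?_⟩
  · obtain ⟨N₁, hN₁⟩ := hg₁.1
    obtain ⟨N₂, hN₂⟩ := hg₂.1
    refine ⟨N₁ + N₂, ((hN₁.norm.add hN₂.norm)).mono' ?_ (Eventually.of_forall fun x => ?_)⟩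
    · have : Continuous fun x : V => (((1 + ‖x‖) ^ (N₁ + N₂))⁻¹ : ℝ) :=
        Continuous.inv₀ (by fun_prop) fun x => by positivity
      exact this.aestronglyMeasurable.smul
        (hg₁.1.aestronglyMeasurable.sub hg₂.1.aestronglyMeasurable)
    · have h1 : (1 : ℝ) ≤ 1 + ‖x‖ := by linarith [norm_nonneg x]
      simp only [Pi.add_apply, norm_smul, norm_inv, norm_pow,
        Real.norm_of_nonneg (zero_le_one.trans h1)]
      calc _ ≤ ((1 + ‖x‖) ^ (N₁ + N₂))⁻¹ * (‖g₁ x‖ + ‖g₂ x‖) := by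
            gcongr
            exact norm_sub_le _ _
        _ ≤ _ := by
            rw [mul_add]
            gcongr <;> first | exact h1 | omega
  · have hT : 𝓕 (T₁ - T₂) = 𝓕 T₁ - 𝓕 T₂ := by
      ext φ
      rfl
    rw [hT]
    have h1 := hg₁.1.exists_clm.1 φ
    have h2 := hg₂.1.exists_clm.1 φ
    simp only [sub_mul]
    rw [integral_sub h1 h2, ← hg₁.2, ← hg₂.2]
    rfl
  · have hF : (𝓕 (F₁ - F₂) : Lp ℂ 2 (volume : Measure V)) = 𝓕 F₁ - 𝓕 F₂ :=
      map_sub (Lp.fourierTransformₗᵢ V ℂ) F₁ F₂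
    rw [hF]
    filter_upwards [Lp.coeFn_sub (𝓕 F₁) (𝓕 F₂), hF₁, hF₂] with ξ h h1 h2
    rw [h, Pi.sub_apply, h1, h2]
    ring

theorem theorem1p3 :
    ∃ C : ℝ, ∀ (k : ℕ) (j : Fin k) (γ : ℝ → Conf (k + 1) → ℂ) (γ₀ : 𝓢'(Conf (k + 1), ℂ))
      (G₀ : Lp ℂ 2 (volume : Measure (Conf (k + 1)))),
      IsFreeSolution γ → Represents γ₀ (γ 0) → IsR γ₀ G₀ →
      ∃ (T : 𝓢'(STConf k, ℂ)) (F : Lp ℂ 2 (volume : Measure (STConf k))),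
        IsB j γ T ∧ IsSTR T F ∧ ‖F‖ ≤ C * ‖G₀‖ := by
  refine ⟨2 * √(1728 * Real.pi ^ 2), fun k j γ γ₀ G₀ hγ h₀ hR => ?_⟩
  obtain ⟨T₁, F₁, hT₁, hF₁, hn₁⟩ := exists_isCollapse (Sum.inl j) hγ h₀ hR
  obtain ⟨T₂, F₂, hT₂, hF₂, hn₂⟩ := exists_isCollapse (Sum.inr j) hγ h₀ hR
  refine ⟨T₁ - T₂, F₁ - F₂, ⟨T₁, T₂, hT₁, hT₂, rfl⟩, IsMultiplierImage.sub hF₁ hF₂, ?_⟩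
  calc ‖F₁ - F₂‖ ≤ ‖F₁‖ + ‖F₂‖ := norm_sub_le _ _
    _ ≤ _ := by linarith

end
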